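/- Let $\mathbb{K}\subset\mathbb{C}$ be a field, $\mathbf{f}=(f_1,\dots,f_N)\in\mathbb{K}[x_1,\dots,x_n]^N$ and $I=\langle f_1,\dots,f_N\rangle$. For $\gamma\in\mathbb{N}^n$ write $|\gamma|=\gamma_1+\dots+\gamma_n$ and $\gamma!=\gamma_1!\cdots\gamma_n!$. Let $E=\{\alpha_0,\dots,\alpha_{\delta-1}\}\subset\mathbb{N}^n$ be a set of $\delta\ge 1$ exponents that is stable under subtraction (if $\alpha\in E$ and $\beta\le\alpha$ componentwise, then $\beta\in E$), with $\alpha_0=0$ and $|\alpha_0|\le\dots\le|\alpha_{\delta-1}|$. Let $o=|\alpha_{\delta-1}|$. Let $\mu$ be the family of $D$ indeterminates $\mu_{\alpha_i,\alpha_k+\mathbf{e}_j}$ indexed by the pairs $(\alpha_i,\alpha_k+\mathbf{e}_j)$ with $\alpha_k+\mathbf{e}_j\notin E$ and $|\alpha_i|\ge|\alpha_k|+1$. For $j=1,\dots,n$ let $\mathtt{M}_j(\mu)$ be the $\delta\times\delta$ matrix whose entry in row $i$ and column $k$ $(0\le i,k\le\delta-1)$ is $1$ if $\alpha_i=\alpha_k+\mathbf{e}_j$,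 is $\mu_{\alpha_i,\alpha_k+\mathbf{e}_j}$ if $\alpha_k+\mathbf{e}_j\notin E$ and $|\alpha_i|\ge|\alpha_k|+1$, and is $0$ otherwise. Put $\mathtt{M}(\mu)^\gamma=\mathtt{M}_1(\mu)^{\gamma_1}\cdots\mathtt{M}_n(\mu)^{\gamma_n}$, $[1]=(1,0,\dots,0)^t$, and for $p\in\mathbb{K}[\mathbf{x}]$ $$\mathcal{N}_{\mathbf{x},\mu}(p)=\sum_{\gamma\in\mathbb{N}^n}\frac1{\gamma!}\,\partial^\gamma(p)(\mathbf{x})\,\mathtt{M}(\mu)^\gamma[1]\in\mathbb{K}[\mathbf{x},\mu]^\delta .$$ The $E$-deflated ideal $I^{(E)}\subset\mathbb{K}[\mathbf{x},\mu]$ is generated by the entries of all $\mathcal{N}_{\mathbf{x},\mu}(f_k)$ and of all commutators $\mathtt{M}_i(\mu)\mathtt{M}_j(\mu)-\mathtt{M}_j(\mu)\mathtt{M}_i(\mu)$. For $\xi\in\mathbb{C}^n$ let $\mathfrak{m}_\xi\subset\mathbb{C}[\mathbf{x}]$ be the maximal ideal at $\xi$. Let $\Lambda=\sum_\beta\lambda_\beta\partial_\xi^\beta\in\mathbb{C}[\partial_\xi]$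 act on $\mathbb{C}[\mathbf{x}]$ by $\Lambda(p)=\sum_\beta\lambda_\beta(\partial^\beta p)(\xi)$, and let $\mathrm{ord}(\Lambda)$ be its degree in $\partial_\xi$. For an ideal $Q\subset\mathbb{C}[\mathbf{x}]$ let $\mathscr{D}=\{\Lambda\in\mathbb{C}[\partial_\xi]:\Lambda(q)=0\ \forall q\in Q\}$, and let $\mathscr{D}_t$ be the set of its elements of order at most $t$. A normalized orthogonal primal-dual pair for $Q$ with exponents $E$ consists of a basis $B=(B_0,\dots,B_{\delta-1})$ of $\mathbb{C}[\mathbf{x}]/Q$ and a basis $\mathbf{\Lambda}=(\Lambda_0,\dots,\Lambda_{\delta-1})$ of $\mathscr{D}$ such that $\Lambda_i(B_j)=1$ if $i=j$ and $0$ otherwise, and: 1. $B_i=(\mathbf{x}-\xi)^{\alpha_i}$ for all $i$, $\alpha_0=0$, and $B$ is connected to $1$ (each $\alpha_i\ne0$ is of the form $\alpha_k+\mathbf{e}_j$ with $\alpha_k\in E$); 2. $\Lambda_0=1_\xi$ and, for all $i$, $\displaystyle\Lambda_i=\frac1{\alpha_i!}\partial_\xi^{\alpha_i}+\sum_{|\beta|\le|\alpha_i|,\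 \beta\notin E}\nu_{\alpha_i,\beta}\frac1{\beta!}\partial_\xi^\beta$ with $\nu_{\alpha_i,\beta}\in\mathbb{C}$; 3. $0=\mathrm{ord}(\Lambda_0)\le\dots\le\mathrm{ord}(\Lambda_{\delta-1})$ and $\mathscr{D}_t=\mathrm{span}\{\Lambda_j:\mathrm{ord}(\Lambda_j)\le t\}$ for all $t\ge0$. Theorem. Let $(\xi,\nu)\in\mathbb{C}^{n+D}$ be an isolated point of the zero set of $I^{(E)}$ in $\mathbb{C}^{n+D}$. Then $\xi$ is a root of $I$. Let $I_\xi$ be the intersection of those primary components of $I\,\mathbb{C}[\mathbf{x}]$ (in any minimal primary decomposition) that are contained in $\mathfrak{m}_\xi$, and let $Q=I_\xi+\mathfrak{m}_\xi^{\,o+1}$. Then there is a normalized orthogonal primal-dual pair $(B,\mathbf{\Lambda})$ for $Q$ with exponents $E$ whose coefficients $\nu_{\alpha_i,\beta}$ at the indices of the variables $\mu$ are the coordinates of $\nu$. It is uniquely determined by $(\xi,\nu)$: if $Q'$ is any ideal of $\mathbb{C}[\mathbf{x}]$ and $(B',\mathbf{\Lambda}')$ is a normalized orthogonal primal-dual pair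 for $Q'$ with exponents $E$ and with these coefficients $\nu$, then $Q'=Q$, $B'=B$ and $\mathbf{\Lambda}'=\mathbf{\Lambda}$. (In particular, all this holds for every simple isolated root $(\xi,\nu)$ of $I^{(E)}$.) -/

import Mathlib

noncomputable section

namespace EDeflation

open MvPolynomial

variable {n d : ℕ}

/-- `A ^ γ := A₁ ^ γ₁ ⋯ Aₙ ^ γₙ` (the factors need not commute, so their order is fixed). -/
def orderedPow {R : Type*} [Monoid R] (A : Fin n → R) (γ : Fin n →₀ ℕ) : R :=
  (List.ofFn fun j => A j ^ γ j).prod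

/-- `γ! := γ₁! ⋯ γₙ!`. -/
def multiFactorial (γ : Fin n →₀ ℕ) : ℕ := ∏ j, (γ j).factorial

/-- The differential operator `∂^γ` on `R[x₁, …, xₙ]`. -/
def iterDeriv (R : Type*) [CommRing R] (γ : Fin n →₀ ℕ) :
    Module.End R (MvPolynomial (Fin n) R) :=
  orderedPow (fun j => (pderiv j : Derivation R (MvPolynomial (Fin n) R)
    (MvPolynomial (Fin n) R)).toLinearMap) γ

/-! ### Exponent sets and the deflated ideal

The set of exponents `E = {α₀, …, α_{δ-1}}` is given by an enumeration
`α : Fin (d + 1) → (Fin n →₀ ℕ)`, so that `δ = d + 1`. -/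

/-- `E` is a set of `δ` exponents that contains `α₀ = 0`, is stable under subtraction, and is
enumerated by nondecreasing total degree. -/
structure IsExponentSet (α : Fin (d + 1) → (Fin n →₀ ℕ)) : Prop where
  injective : Function.Injective α
  zero : α 0 = 0
  stable : ∀ i β, β ≤ α i → β ∈ Set.range α
  monotone : Monotone fun i => (α i).degree

/-- `(i, β)` indexes a variable `μ_{αᵢ, β}`: the exponent `β` has the form `αₖ + eⱼ`, it is not
in `E`, and `|αᵢ| ≥ |αₖ| + 1`. -/
def IsVar (α : Fin (d + 1) → (Fin n →₀ ℕ)) (v : Fin (d + 1) × (Fin n →₀ ℕ)) : Prop :=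
  v.2 ∉ Set.range α ∧
    ∃ k j, v.2 = α k + Finsupp.single j 1 ∧ (α k).degree + 1 ≤ (α v.1).degree

/-- The index set of the variables `μ`; its cardinality is the number `D`. -/
abbrev Var (α : Fin (d + 1) → (Fin n →₀ ℕ)) : Type :=
  {v : Fin (d + 1) × (Fin n →₀ ℕ) // IsVar α v}

open Classical in
/-- The multiplication matrix `M_j(μ)` with parameters `μ` in a commutative ring: its entry in row
`i` and column `k` is `μ_{αᵢ, αₖ + eⱼ}`, where this symbol means `1` if `αₖ + eⱼ = αᵢ`, and `0` if
`αₖ + eⱼ` is another element of `E` or if there is no variable with this index. -/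
def multMatrix {R : Type*} [CommRing R] (α : Fin (d + 1) → (Fin n →₀ ℕ)) (μ : Var α → R)
    (j : Fin n) : Matrix (Fin (d + 1)) (Fin (d + 1)) R :=
  Matrix.of fun i k =>
    if α i = α k + Finsupp.single j 1 then 1
    else if h : IsVar α (i, α k + Finsupp.single j 1) then μ ⟨_, h⟩ else 0

/-- The polynomial ring `R[x, μ]`. -/
abbrev PolyXMu (R : Type*) [CommRing R] (α : Fin (d + 1) → (Fin n →₀ ℕ)) : Type _ :=
  MvPolynomial (Fin n ⊕ Var α) R

/-- The parametric multiplication matrix `M_j(μ)`, with entries in `K[x, μ]`. -/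
def parMatrix (K : Type*) [Field K] (α : Fin (d + 1) → (Fin n →₀ ℕ)) (j : Fin n) :
    Matrix (Fin (d + 1)) (Fin (d + 1)) (PolyXMu K α) :=
  multMatrix α (fun v => X (Sum.inr v)) j

/-- The parametric normal form `∑_γ (1 / γ!) ∂^γ(p)(x) M(μ)^γ [1]`, a vector of length `δ` over
`K[x, μ]`. Only finitely many `γ` contribute, as `∂^γ(p) = 0` for large `γ`. -/
def normalForm {K : Type*} [Field K] (α : Fin (d + 1) → (Fin n →₀ ℕ))
    (p : MvPolynomial (Fin n) K) : Fin (d + 1) → PolyXMu K α :=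
  ∑ᶠ γ : Fin n →₀ ℕ,
    (C ((multiFactorial γ : K)⁻¹) * rename Sum.inl (iterDeriv K γ p) : PolyXMu K α) •
      (orderedPow (parMatrix K α) γ).mulVec (Pi.single 0 1)

/-- The `E`-deflated ideal of `f₁, …, f_N`, generated in `K[x, μ]` by the entries of the normal
forms of the `fₖ` and of the commutators of the parametric multiplication matrices. -/
def deflatedIdeal {K : Type*} [Field K] {N : ℕ} (α : Fin (d + 1) → (Fin n →₀ ℕ))
    (f : Fin N → MvPolynomial (Fin n) K) : Ideal (PolyXMu K α) :=
  Ideal.span {g | ∃ k i, g = normalForm α (f k) i} ⊔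
    Ideal.span {g | ∃ i j a b,
      g = (parMatrix K α i * parMatrix K α j - parMatrix K α j * parMatrix K α i) a b}

/-- `p` is an isolated point of the set `V`. -/
def IsIsolatedIn {T : Type*} [TopologicalSpace T] (V : Set T) (p : T) : Prop :=
  ∃ U : Set T, IsOpen U ∧ V ∩ U = {p}

/-! ### Dual space and orthogonal primal-dual basis pairs

Elements of `ℂ[∂_ξ]` are written as polynomials in `n` variables, the `j`-th of which stands for
`∂_{j, ξ}`. -/

/-- The functional `p ↦ Λ(p)` on `ℂ[x]` of an element `Λ` of `ℂ[∂_ξ]`; the monomial `∂_ξ^β` acts by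
`p ↦ (∂^β p)(ξ)`. -/
def diffFunctional (ξ : Fin n → ℂ) :
    MvPolynomial (Fin n) ℂ →ₗ[ℂ] Module.Dual ℂ (MvPolynomial (Fin n) ℂ) :=
  (basisMonomials (Fin n) ℂ).constr ℂ fun β => (aeval ξ).toLinearMap ∘ₗ iterDeriv ℂ β

/-- The space `𝒟 = Q^⊥ ∩ ℂ[∂_ξ]`. -/
def dualSpace (ξ : Fin n → ℂ) (Q : Ideal (MvPolynomial (Fin n) ℂ)) :
    Submodule ℂ (MvPolynomial (Fin n) ℂ) :=
  (Q.restrictScalars ℂ).dualAnnihilator.comap (diffFunctional ξ)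

/-- The space `𝒟_t` of the elements of `𝒟` of order at most `t`. -/
def dualSpaceOrd (ξ : Fin n → ℂ) (Q : Ideal (MvPolynomial (Fin n) ℂ)) (t : ℕ) :
    Submodule ℂ (MvPolynomial (Fin n) ℂ) :=
  dualSpace ξ Q ⊓ restrictTotalDegree (Fin n) ℂ t

/-- `(x - ξ)^β`. -/
def shiftedMonomial (ξ : Fin n → ℂ) (β : Fin n →₀ ℕ) : MvPolynomial (Fin n) ℂ :=
  ∏ j, (X j - C (ξ j)) ^ β j

/-- The coefficient `ν_β` of `Λ = ∑_β ν_β (1 / β!) ∂_ξ^β`. -/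
def dualCoeff (Λ : MvPolynomial (Fin n) ℂ) (β : Fin n →₀ ℕ) : ℂ :=
  (multiFactorial β : ℂ) * coeff β Λ

/-- `B` and `Λ` are orthogonal bases of `ℂ[x]/Q` and of its dual space `𝒟 = Q^⊥`. -/
structure IsOrthogonalPair (ξ : Fin n → ℂ) (Q : Ideal (MvPolynomial (Fin n) ℂ))
    (B Λ : Fin (d + 1) → MvPolynomial (Fin n) ℂ) : Prop where
  primal_independent : LinearIndependent ℂ fun i => Ideal.Quotient.mk Q (B i)
  primal_span : Submodule.span ℂ (Set.range fun i => Ideal.Quotient.mk Q (B i)) = ⊤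
  dual_independent : LinearIndependent ℂ Λ
  dual_span : Submodule.span ℂ (Set.range Λ) = dualSpace ξ Q
  orthogonal : ∀ i j, diffFunctional ξ (Λ i) (B j) = if i = j then 1 else 0

/-- The normalization of an orthogonal primal-dual basis pair of `ℂ[x]/Q` with exponents
`α₀, …, α_{δ-1}`. -/
structure IsNormalizedPair (α : Fin (d + 1) → (Fin n →₀ ℕ)) (ξ : Fin n → ℂ)
    (Q : Ideal (MvPolynomial (Fin n) ℂ)) (B Λ : Fin (d + 1) → MvPolynomial (Fin n) ℂ) : Prop
    extends IsOrthogonalPair ξ Q B Λ where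
  /-- The primal basis is `(x - ξ)^{α₀}, …, (x - ξ)^{α_{δ-1}}`, … -/
  primal_form : ∀ i, B i = shiftedMonomial ξ (α i)
  /-- … it starts with `1`, … -/
  exponent_zero : α 0 = 0
  /-- … and it is connected to `1`. -/
  connected : ∀ i, α i = 0 ∨ ∃ k j, α i = α k + Finsupp.single j 1
  dual_zero : Λ 0 = 1
  /-- `Λᵢ = (1 / αᵢ!) ∂^{αᵢ} + ∑ ν_{αᵢ, β} (1 / β!) ∂^β` over `β ∉ E` with `|β| ≤ |αᵢ|`. -/
  dual_form : ∀ i, ∃ c : (Fin n →₀ ℕ) →₀ ℂ,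
    (∀ β ∈ c.support, β.degree ≤ (α i).degree ∧ β ∉ Set.range α) ∧
    Λ i = monomial (α i) ((multiFactorial (α i) : ℂ)⁻¹) +
      c.sum fun β ν => monomial β (ν * (multiFactorial β : ℂ)⁻¹)
  order_zero : (Λ 0).totalDegree = 0
  order_monotone : Monotone fun i => (Λ i).totalDegree
  order_span : ∀ t, dualSpaceOrd ξ Q t = Submodule.span ℂ {L | ∃ j, L = Λ j ∧ L.totalDegree ≤ t}

/-- The maximal ideal `𝔪_ξ` of `ℂ[x]`. -/
def maxIdealAt (ξ : Fin n → ℂ) : Ideal (MvPolynomial (Fin n) ℂ) :=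
  Ideal.span (Set.range fun j => X j - C (ξ j))

open Classical in
/-- The intersection of those members of the finite set `t` of ideals that are contained in
`𝔪_ξ`. -/
def interBelow (t : Finset (Ideal (MvPolynomial (Fin n) ℂ))) (ξ : Fin n → ℂ) :
    Ideal (MvPolynomial (Fin n) ℂ) :=
  (t.filter fun J => J ≤ maxIdealAt ξ).inf id

end EDeflation

end

noncomputable section

namespace EDeflation

open MvPolynomial

variable {n d : ℕ}

/-! ### Iterated derivatives and Taylor expansion -/

/-! Write `w γ = M(ν)^γ [1]` and let Λᵢ be the functional sending `(x - ξ)^γ` to `w γ i`. By Taylor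
expansion at `ξ`, the entries of the normal form of `p` at `(ξ, ν)` are the values Λᵢ(p).
Commutation of the matrices amounts to solvability of the recursion `w 0 = [1]`, `w (γ + eⱼ) = Mⱼ (w
γ)`. So `(ξ, ν)` is a zero of the deflated ideal exactly when such a `w` exists and all Λᵢ kill all
`fₖ` (`mem_zeroLocus_deflatedIdeal`).

The recursion says Λᵢ((xⱼ - ξⱼ) p) = ∑ₖ (Mⱼ)ᵢₖ Λₖ(p) (`functional_mul`), so the common kernel of the
Λᵢ is an ideal, `kerIdeal`. As (Mⱼ)ᵢₖ vanishes unless |αₖ| < |αᵢ|, this ideal contains 𝔪_ξ^(o+1),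
and polynomials not vanishing at `ξ` are units modulo it. Hence it contains `Q`.

Isolation gives equality (`kerIdeal_le_of_isIsolatedIn`). If `Q` were smaller, a Nakayama argument
would give a nonzero functional `c` that kills `Q` and the monomials with exponents in `E`, and
whose derivatives lie in the span of the Λₖ (`exists_moments`). Replacing the last functional by its
sum with `s • c` preserves the recursion and the equations `Λᵢ(fₖ) = 0` for every complex `s`
(`deform`), so a whole line of zeros would pass through `(ξ, ν)`.

The Λᵢ then form the dual basis. Conversely, the coefficients of any normalized pair satisfy the
same recursion (`IsNormalizedPair.isMultSeq`), whose solution is determined by `ν`; this is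
uniqueness. -/

lemma orderedPow_eq_map {R : Type*} [Monoid R] (A : Fin n → R) (γ : Fin n →₀ ℕ) :
    orderedPow A γ = ((List.finRange n).map fun j => A j ^ γ j).prod := by
  rw [orderedPow, List.ofFn_eq_map]

lemma orderedPow_zero {R : Type*} [Monoid R] (A : Fin n → R) : orderedPow A 0 = 1 := by
  rw [orderedPow_eq_map]
  exact List.prod_eq_one (by simp)

lemma map_orderedPow {R S F : Type*} [Monoid R] [Monoid S] [FunLike F R S] [MonoidHomClass F R S]
    (φ : F) (A : Fin n → R) (γ : Fin n →₀ ℕ) :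
    φ (orderedPow A γ) = orderedPow (fun j => φ (A j)) γ := by
  simp [orderedPow_eq_map, map_list_prod, Function.comp_def]

/-- `T` is a bare function between modules over different rings, so that both translation by `ξ` and
change of coefficients are covered. -/
lemma orderedPow_intertwine {R S M N : Type*} [Semiring R] [Semiring S] [AddCommMonoid M]
    [AddCommMonoid N] [Module R M] [Module S N] (A : Fin n → Module.End R M)
    (B : Fin n → Module.End S N) (T : M → N) (h : ∀ j x, T (A j x) = B j (T x))
    (γ : Fin n →₀ ℕ) (x : M) : T (orderedPow A γ x) = orderedPow B γ (T x) := by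
  have hpow (j : Fin n) (k : ℕ) (y : M) : T ((A j ^ k) y) = (B j ^ k) (T y) := by
    induction k generalizing y with
    | zero => simp
    | succ k ih => rw [pow_succ, pow_succ, Module.End.mul_apply, Module.End.mul_apply, ih, h]
  rw [orderedPow_eq_map, orderedPow_eq_map]
  induction List.finRange n with
  | nil => simp
  | cons j l ih => simp only [List.map_cons, List.prod_cons, Module.End.mul_apply, hpow, ih]

lemma orderedPow_add_single {R : Type*} [Monoid R] (A : Fin n → R)
    (hA : ∀ i j, Commute (A i) (A j)) (γ : Fin n →₀ ℕ) (j : Fin n) :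
    orderedPow A (γ + Finsupp.single j 1) = A j * orderedPow A γ := by
  rw [orderedPow_eq_map, orderedPow_eq_map]
  have key (l : List (Fin n)) (hl : l.Nodup) :
      (l.map fun i => A i ^ (γ + Finsupp.single j 1 : Fin n →₀ ℕ) i).prod =
        if j ∈ l then A j * (l.map fun i => A i ^ γ i).prod
        else (l.map fun i => A i ^ γ i).prod := by
    induction l with
    | nil => simp
    | cons i l ih =>
      rw [List.nodup_cons] at hl
      rw [List.map_cons, List.prod_cons, ih hl.2, List.map_cons, List.prod_cons]
      by_cases hij : i = j
      · subst hij
        simp [hl.1, pow_succ', mul_assoc]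
      · have hij' : ¬ j = i := fun h => hij h.symm
        by_cases hj : j ∈ l
        · simp only [hj, if_true, List.mem_cons, or_true, Finsupp.add_apply,
            Finsupp.single_apply, hij', if_false, add_zero]
          rw [← mul_assoc, ← mul_assoc, ((hA i j).pow_left (γ i)).eq]
        · simp [hj, hij']
  simpa using key _ (List.nodup_finRange n)

lemma coeff_pderiv_pow {R : Type*} [CommRing R] (j : Fin n) (k : ℕ)
    (p : MvPolynomial (Fin n) R) (m : Fin n →₀ ℕ) :
    coeff m (((pderiv j : Derivation R (MvPolynomial (Fin n) R)
      (MvPolynomial (Fin n) R)).toLinearMap ^ k) p) =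
      ((m j + k).descFactorial k : R) * coeff (m + Finsupp.single j k) p := by
  induction k generalizing p with
  | zero => simp
  | succ k ih =>
    rw [pow_succ, Module.End.mul_apply, ih]
    change _ * coeff _ (pderiv j p) = _
    rw [coeff_pderiv, add_assoc, ← Finsupp.single_add, ← add_assoc (m j),
      Nat.succ_descFactorial_succ]
    simp
    ring

lemma coeff_iterDeriv {R : Type*} [CommRing R] (γ : Fin n →₀ ℕ) (p : MvPolynomial (Fin n) R)
    (m : Fin n →₀ ℕ) :
    coeff m (iterDeriv R γ p) =
      (∏ j, ((m j + γ j).descFactorial (γ j) : R)) * coeff (m + γ) p := by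
  have key (l : List (Fin n)) (hl : l.Nodup) : ∀ m : Fin n →₀ ℕ,
      coeff m ((l.map fun j => (pderiv j : Derivation R (MvPolynomial (Fin n) R)
        (MvPolynomial (Fin n) R)).toLinearMap ^ γ j).prod p) =
      (l.map fun j => ((m j + γ j).descFactorial (γ j) : R)).prod *
        coeff (m + (l.map fun j => Finsupp.single j (γ j)).sum) p := by
    induction l with
    | nil => simp
    | cons i l ih =>
      intro m
      rw [List.nodup_cons] at hl
      rw [List.map_cons, List.prod_cons, Module.End.mul_apply, coeff_pderiv_pow, ih hl.2]
      rw [List.map_cons, List.prod_cons, List.map_cons, List.sum_cons, ← mul_assoc, add_assoc]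
      congr 3
      refine List.map_congr_left fun j hj => ?_
      have : i ≠ j := fun h => hl.1 (h ▸ hj)
      simp [this]
  rw [iterDeriv, orderedPow_eq_map, key _ (List.nodup_finRange n) m, ← List.ofFn_eq_map,
    List.prod_ofFn, ← List.ofFn_eq_map, List.sum_ofFn, Finsupp.univ_sum_single]

lemma coeff_zero_iterDeriv {R : Type*} [CommRing R] (γ : Fin n →₀ ℕ)
    (p : MvPolynomial (Fin n) R) :
    coeff 0 (iterDeriv R γ p) = multiFactorial γ * coeff γ p := by
  simp [coeff_iterDeriv, multiFactorial, Nat.descFactorial_self]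

lemma finite_iterDeriv_ne_zero {R : Type*} [CommRing R] (p : MvPolynomial (Fin n) R) :
    {γ : Fin n →₀ ℕ | iterDeriv R γ p ≠ 0}.Finite := by
  refine (Finsupp.finite_of_degree_le p.totalDegree).subset fun γ hγ => ?_
  obtain ⟨m, hm⟩ := exists_coeff_ne_zero hγ
  rw [coeff_iterDeriv] at hm
  have h := le_totalDegree (mem_support_iff.2 (right_ne_zero_of_mul hm))
  have h2 : (m + γ).degree ≤ p.totalDegree := h
  rw [map_add] at h2
  exact (Nat.le_add_left _ _).trans h2

lemma multiFactorial_ne_zero (γ : Fin n →₀ ℕ) : (multiFactorial γ : ℂ) ≠ 0 := by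
  rw [Nat.cast_ne_zero, multiFactorial]
  exact Finset.prod_ne_zero_iff.2 fun j _ => Nat.factorial_ne_zero _

/-- The substitution `p ↦ p(x + ξ)`. -/
def translate (ξ : Fin n → ℂ) : MvPolynomial (Fin n) ℂ →ₐ[ℂ] MvPolynomial (Fin n) ℂ :=
  aeval fun j => X j + C (ξ j)

lemma translate_neg_translate (ξ : Fin n → ℂ) (p : MvPolynomial (Fin n) ℂ) :
    translate (-ξ) (translate ξ p) = p := by
  have : (translate (-ξ)).comp (translate ξ) = AlgHom.id ℂ _ := by
    ext j : 1
    simp [translate, algHom_C]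
  exact DFunLike.congr_fun this p

lemma translate_pderiv (ξ : Fin n → ℂ) (j : Fin n) (p : MvPolynomial (Fin n) ℂ) :
    translate ξ (pderiv j p) = pderiv j (translate ξ p) := by
  induction p using MvPolynomial.induction_on with
  | C a => simp [translate, algHom_C]
  | add p q hp hq => simp [hp, hq]
  | mul_X p i hp =>
    have hX : translate ξ (pderiv j (X i)) = pderiv j (translate ξ (X i)) := by
      by_cases h : i = j
      · subst h; simp [translate]
      · simp [translate, pderiv_X_of_ne h]
    simp only [pderiv_mul, map_add, map_mul, hp, hX]

lemma coeff_zero_translate (ξ : Fin n → ℂ) (p : MvPolynomial (Fin n) ℂ) :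
    coeff 0 (translate ξ p) = aeval ξ p := by
  have : (aeval (0 : Fin n → ℂ)).comp (translate ξ) = aeval ξ := by
    ext j : 1
    simp [translate]
  rw [← this, AlgHom.comp_apply, aeval_zero]
  simp [constantCoeff_eq]

/-- Taylor's formula: translation commutes with derivatives and moves the evaluation point to 0,
where derivatives read off coefficients. -/
lemma aeval_iterDeriv (ξ : Fin n → ℂ) (γ : Fin n →₀ ℕ) (p : MvPolynomial (Fin n) ℂ) :
    aeval ξ (iterDeriv ℂ γ p) = multiFactorial γ * coeff γ (translate ξ p) := by
  rw [← coeff_zero_translate, ← coeff_zero_iterDeriv, iterDeriv]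
  rw [orderedPow_intertwine _ _ (translate ξ) fun j q => translate_pderiv ξ j q]

lemma map_iterDeriv {R S : Type*} [CommRing R] [CommRing S] (φ : R →+* S) (γ : Fin n →₀ ℕ)
    (p : MvPolynomial (Fin n) R) :
    MvPolynomial.map φ (iterDeriv R γ p) = iterDeriv S γ (MvPolynomial.map φ p) :=
  orderedPow_intertwine _ _ (MvPolynomial.map φ) (fun _ _ => pderiv_map.symm) γ p

/-! ### Shifted monomials and functionals given by their moments -/

lemma translate_shiftedMonomial (ξ : Fin n → ℂ) (γ : Fin n →₀ ℕ) :
    translate ξ (shiftedMonomial ξ γ) = monomial γ 1 := by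
  simp [shiftedMonomial, translate, algHom_C, monomial_eq, Finsupp.prod_fintype]

lemma shiftedMonomial_zero (ξ : Fin n → ℂ) : shiftedMonomial ξ 0 = 1 := by
  simp [shiftedMonomial]

lemma shiftedMonomial_add_single (ξ : Fin n → ℂ) (γ : Fin n →₀ ℕ) (j : Fin n) :
    shiftedMonomial ξ (γ + Finsupp.single j 1) = (X j - C (ξ j)) * shiftedMonomial ξ γ := by
  rw [shiftedMonomial, shiftedMonomial]
  simp only [Finsupp.add_apply, pow_add, Finset.prod_mul_distrib]
  rw [mul_comm]
  congr 1
  rw [Finset.prod_eq_single j] <;> simp +contextual [eq_comm]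

lemma linearMap_ext_shiftedMonomial {M : Type*} [AddCommMonoid M] [Module ℂ M] (ξ : Fin n → ℂ)
    {F G : MvPolynomial (Fin n) ℂ →ₗ[ℂ] M}
    (h : ∀ γ, F (shiftedMonomial ξ γ) = G (shiftedMonomial ξ γ)) : F = G := by
  have h2 : F ∘ₗ (translate (-ξ)).toLinearMap = G ∘ₗ (translate (-ξ)).toLinearMap := by
    refine (basisMonomials (Fin n) ℂ).ext fun γ => ?_
    simp only [coe_basisMonomials, ← translate_shiftedMonomial ξ, LinearMap.comp_apply,
      AlgHom.toLinearMap_apply, translate_neg_translate, h]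
  refine LinearMap.ext fun p => ?_
  have := DFunLike.congr_fun h2 (translate ξ p)
  simpa [translate_neg_translate] using this

lemma constr_basisMonomials_monomial {M : Type*} [AddCommGroup M] [Module ℂ M]
    (F : (Fin n →₀ ℕ) → M) (γ : Fin n →₀ ℕ) :
    (basisMonomials (Fin n) ℂ).constr ℂ F (monomial γ 1) = F γ := by
  simpa only [coe_basisMonomials] using (basisMonomials (Fin n) ℂ).constr_basis ℂ F γ

/-- The functional on `ℂ[x]` that takes the value `c γ` at `(x - ξ)^γ`. -/
def momentFunctional (ξ : Fin n → ℂ) (c : (Fin n →₀ ℕ) → ℂ) :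
    Module.Dual ℂ (MvPolynomial (Fin n) ℂ) :=
  (basisMonomials (Fin n) ℂ).constr ℂ c ∘ₗ (translate ξ).toLinearMap

@[simp]
lemma momentFunctional_shiftedMonomial (ξ : Fin n → ℂ) (c : (Fin n →₀ ℕ) → ℂ)
    (γ : Fin n →₀ ℕ) : momentFunctional ξ c (shiftedMonomial ξ γ) = c γ := by
  rw [momentFunctional, LinearMap.comp_apply, AlgHom.toLinearMap_apply,
    translate_shiftedMonomial, constr_basisMonomials_monomial]

lemma momentFunctional_apply (ξ : Fin n → ℂ) (c : (Fin n →₀ ℕ) → ℂ)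
    (p : MvPolynomial (Fin n) ℂ) :
    momentFunctional ξ c p = ∑ᶠ γ, coeff γ (translate ξ p) * c γ := by
  rw [momentFunctional, LinearMap.comp_apply, Module.Basis.constr_apply, Finsupp.sum,
    finsum_eq_sum_of_support_subset]
  · rfl
  · intro γ hγ
    exact Finsupp.mem_support_iff.2 (left_ne_zero_of_mul hγ)

lemma diffFunctional_shiftedMonomial (ξ : Fin n → ℂ) (Λ : MvPolynomial (Fin n) ℂ)
    (γ : Fin n →₀ ℕ) : diffFunctional ξ Λ (shiftedMonomial ξ γ) = dualCoeff Λ γ := by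
  have : LinearMap.applyₗ (shiftedMonomial ξ γ) ∘ₗ diffFunctional ξ =
      (multiFactorial γ : ℂ) • lcoeff ℂ γ := by
    refine (basisMonomials (Fin n) ℂ).ext fun β => ?_
    simp only [LinearMap.comp_apply, LinearMap.applyₗ_apply_apply, diffFunctional,
      constr_basisMonomials_monomial, AlgHom.toLinearMap_apply, aeval_iterDeriv,
      translate_shiftedMonomial, LinearMap.smul_apply, lcoeff_apply, coe_basisMonomials,
      coeff_monomial, smul_eq_mul]
    by_cases h : β = γ
    · simp [h]
    · simp [h, Ne.symm h]
  exact DFunLike.congr_fun this Λ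

lemma diffFunctional_eq_momentFunctional (ξ : Fin n → ℂ) (Λ : MvPolynomial (Fin n) ℂ) :
    diffFunctional ξ Λ = momentFunctional ξ (dualCoeff Λ) :=
  linearMap_ext_shiftedMonomial ξ fun γ => by
    rw [diffFunctional_shiftedMonomial, momentFunctional_shiftedMonomial]

lemma dualCoeff_injective {Λ Λ' : MvPolynomial (Fin n) ℂ}
    (h : ∀ γ, dualCoeff Λ γ = dualCoeff Λ' γ) : Λ = Λ' := by
  ext γ
  exact mul_left_cancel₀ (multiFactorial_ne_zero γ) (h γ)

lemma diffFunctional_injective (ξ : Fin n → ℂ) : Function.Injective (diffFunctional ξ) := by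
  intro Λ Λ' h
  refine dualCoeff_injective fun γ => ?_
  rw [← diffFunctional_shiftedMonomial ξ, h, diffFunctional_shiftedMonomial]

/-! ### Sequences generated by the multiplication matrices -/

lemma exponent_induction {P : (Fin n →₀ ℕ) → Prop} (zero : P 0)
    (add : ∀ γ j, P γ → P (γ + Finsupp.single j 1)) (γ : Fin n →₀ ℕ) : P γ := by
  induction h : γ.degree generalizing γ with
  | zero => rwa [(Finsupp.degree_eq_zero_iff γ).1 h]
  | succ k ih =>
    obtain ⟨j, hj⟩ : ∃ j, γ j ≠ 0 := by
      by_contra! hc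
      rw [show γ = 0 from Finsupp.ext hc, map_zero] at h
      omega
    have hle : Finsupp.single j 1 ≤ γ := by
      rw [Finsupp.single_le_iff]; omega
    have hγ : γ - Finsupp.single j 1 + Finsupp.single j 1 = γ := tsub_add_cancel_of_le hle
    rw [← hγ]
    refine add _ _ (ih _ ?_)
    rw [← hγ, map_add, Finsupp.degree_single] at h
    omega

lemma multMatrix_map {R S : Type*} [CommRing R] [CommRing S] (φ : R →+* S)
    (α : Fin (d + 1) → (Fin n →₀ ℕ)) (μ : Var α → R) (j : Fin n) :
    φ.mapMatrix (multMatrix α μ j) = multMatrix α (fun v => φ (μ v)) j := by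
  ext i k
  simp only [RingHom.mapMatrix_apply, Matrix.map_apply, multMatrix, Matrix.of_apply]
  split_ifs <;> simp

/-- `w γ = M(μ)^γ [1]`, expressed by a recursion. -/
structure IsMultSeq (α : Fin (d + 1) → (Fin n →₀ ℕ)) (μ : Var α → ℂ)
    (w : (Fin n →₀ ℕ) → Fin (d + 1) → ℂ) : Prop where
  zero : w 0 = Pi.single 0 1
  add_single : ∀ γ j, w (γ + Finsupp.single j 1) = (multMatrix α μ j).mulVec (w γ)

lemma IsExponentSet.exists_add_single {α : Fin (d + 1) → (Fin n →₀ ℕ)} (hα : IsExponentSet α)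
    {i : Fin (d + 1)} (hi : α i ≠ 0) : ∃ k j, α i = α k + Finsupp.single j 1 := by
  obtain ⟨j, hj⟩ : ∃ j, α i j ≠ 0 := by
    by_contra! hc
    exact hi (Finsupp.ext hc)
  have hle : Finsupp.single j 1 ≤ α i := by
    rw [Finsupp.single_le_iff]; omega
  obtain ⟨k, hk⟩ := hα.stable i (α i - Finsupp.single j 1) tsub_le_self
  exact ⟨k, j, by rw [hk, tsub_add_cancel_of_le hle]⟩

section multMatrix

variable {α : Fin (d + 1) → (Fin n →₀ ℕ)} {μ : Var α → ℂ}

lemma multMatrix_eq_one {i k : Fin (d + 1)} {j : Fin n}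
    (h : α i = α k + Finsupp.single j 1) : multMatrix α μ j i k = 1 := by
  simp [multMatrix, h]

lemma multMatrix_eq_zero_of_mem (hα : IsExponentSet α) {i k l : Fin (d + 1)} {j : Fin n}
    (h : α l = α k + Finsupp.single j 1) (hil : i ≠ l) : multMatrix α μ j i k = 0 := by
  have h1 : ¬ α i = α k + Finsupp.single j 1 := fun h' => hil (hα.injective (h'.trans h.symm))
  have h2 : ¬ IsVar α (i, α k + Finsupp.single j 1) := fun h' => h'.1 ⟨l, h⟩
  simp [multMatrix, h1, h2]

lemma multMatrix_eq_var {i k : Fin (d + 1)} {j : Fin n}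
    (h : IsVar α (i, α k + Finsupp.single j 1)) : multMatrix α μ j i k = μ ⟨_, h⟩ := by
  have h1 : ¬ α i = α k + Finsupp.single j 1 := fun h' => h.1 ⟨i, h'⟩
  simp [multMatrix, h1, h]

lemma multMatrix_eq_zero_of_degree_le {i k : Fin (d + 1)} {j : Fin n}
    (h : (α i).degree ≤ (α k).degree) : multMatrix α μ j i k = 0 := by
  have h1 : ¬ α i = α k + Finsupp.single j 1 := fun h' => by
    rw [h', map_add, Finsupp.degree_single] at h
    omega
  have h2 : ¬ IsVar α (i, α k + Finsupp.single j 1) := fun h' => by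
    obtain ⟨k', j', hk, hle⟩ := h'.2
    have := congrArg Finsupp.degree hk
    simp only [map_add, Finsupp.degree_single] at this hle
    omega
  simp [multMatrix, h1, h2]

/-- The entries of the multiplication matrices are determined by their values at the variables. -/
lemma eq_multMatrix (hα : IsExponentSet α) (i : Fin (d + 1)) (c : (Fin n →₀ ℕ) → ℂ)
    (hE : ∀ l, c (α l) = if i = l then 1 else 0) (hμ : ∀ v : Var α, v.1.1 = i → c v.1.2 = μ v)
    (hdeg : ∀ γ, (α i).degree < γ.degree → c γ = 0) (k : Fin (d + 1)) (j : Fin n) :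
    c (α k + Finsupp.single j 1) = multMatrix α μ j i k := by
  by_cases hmem : ∃ l, α l = α k + Finsupp.single j 1
  · obtain ⟨l, hl⟩ := hmem
    rw [← hl, hE]
    split_ifs with hil
    · rw [multMatrix_eq_one (hil ▸ hl)]
    · rw [multMatrix_eq_zero_of_mem hα hl hil]
  · by_cases hle : (α i).degree ≤ (α k).degree
    · rw [multMatrix_eq_zero_of_degree_le hle, hdeg]
      rw [map_add, Finsupp.degree_single]
      omega
    · have hv : IsVar α (i, α k + Finsupp.single j 1) :=
        ⟨hmem, k, j, rfl, by change _ ≤ (α i).degree; omega⟩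
      rw [multMatrix_eq_var hv, ← hμ ⟨_, hv⟩ rfl]

end multMatrix

namespace IsMultSeq

variable {α : Fin (d + 1) → (Fin n →₀ ℕ)} {μ : Var α → ℂ}
  {w w' : (Fin n →₀ ℕ) → Fin (d + 1) → ℂ}

lemma unique (hw : IsMultSeq α μ w) (hw' : IsMultSeq α μ w') : w = w' := by
  funext γ
  induction γ using exponent_induction with
  | zero => rw [hw.zero, hw'.zero]
  | add γ j h => rw [hw.add_single, hw'.add_single, h]

lemma orderedPow (h : ∀ i j, Commute (multMatrix α μ i) (multMatrix α μ j)) :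
    IsMultSeq α μ fun γ => (orderedPow (multMatrix α μ) γ).mulVec (Pi.single 0 1) where
  zero := by rw [orderedPow_zero, Matrix.one_mulVec]
  add_single γ j := by rw [orderedPow_add_single _ h, Matrix.mulVec_mulVec]

/-- Column `k` of `Mⱼ` is a unit vector whenever `αₖ + eⱼ` lies in `E`, and every exponent of `E` is
reached from 0 by such steps inside `E`. -/
lemma apply_exponent (hα : IsExponentSet α) (hw : IsMultSeq α μ w) (k : Fin (d + 1)) :
    w (α k) = Pi.single k 1 := by
  induction h : (α k).degree using Nat.strong_induction_on generalizing k with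
  | _ m ih =>
    by_cases h0 : α k = 0
    · have : k = 0 := hα.injective (h0.trans hα.zero.symm)
      rw [this, hα.zero, hw.zero]
    · obtain ⟨l, j, hl⟩ := hα.exists_add_single h0
      have hdeg : (α l).degree < m := by
        rw [← h, hl, map_add, Finsupp.degree_single]
        omega
      rw [hl, hw.add_single, ih _ hdeg l rfl, Matrix.mulVec_single_one]
      funext i
      rw [Matrix.col_apply]
      by_cases hik : i = k
      · subst hik
        rw [multMatrix_eq_one hl, Pi.single_eq_same]
      · rw [multMatrix_eq_zero_of_mem hα hl hik, Pi.single_eq_of_ne hik]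

/-- Since the `w (α k)` are the unit vectors, column `k` of either product is `w (α k + eᵢ + eⱼ)`,
which is symmetric in `i` and `j`. -/
lemma commute (hα : IsExponentSet α) (hw : IsMultSeq α μ w) (i j : Fin n) :
    Commute (multMatrix α μ i) (multMatrix α μ j) := by
  refine Matrix.ext_of_mulVec_single fun k => ?_
  rw [← hw.apply_exponent hα, ← Matrix.mulVec_mulVec, ← Matrix.mulVec_mulVec, ← hw.add_single,
    ← hw.add_single, ← hw.add_single, ← hw.add_single, add_right_comm]

/-- Each matrix strictly raises the degree of the exponents labelling the coordinates. -/
lemma apply_eq_zero (hw : IsMultSeq α μ w) (γ : Fin n →₀ ℕ) (i : Fin (d + 1))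
    (h : (α i).degree < γ.degree) : w γ i = 0 := by
  induction γ using exponent_induction generalizing i with
  | zero => simp at h
  | add γ j ih =>
    rw [hw.add_single, Matrix.mulVec, dotProduct]
    refine Finset.sum_eq_zero fun k _ => ?_
    rw [map_add, Finsupp.degree_single] at h
    by_cases hk : (α i).degree ≤ (α k).degree
    · rw [multMatrix_eq_zero_of_degree_le hk, zero_mul]
    · rw [ih k (by omega), mul_zero]

lemma apply_border (hα : IsExponentSet α) (hw : IsMultSeq α μ w) (i k : Fin (d + 1)) (j : Fin n) :
    w (α k + Finsupp.single j 1) i = multMatrix α μ j i k := by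
  rw [hw.add_single, hw.apply_exponent hα, Matrix.mulVec_single_one, Matrix.col_apply]

end IsMultSeq

/-! ### Zeros of the deflated ideal -/

lemma aeval_normalForm (K : Subfield ℂ) (α : Fin (d + 1) → (Fin n →₀ ℕ)) (ξ : Fin n → ℂ)
    (ν : Var α → ℂ) (p : MvPolynomial (Fin n) K) (i : Fin (d + 1)) :
    aeval (Sum.elim ξ ν) (normalForm α p i) =
      momentFunctional ξ (fun γ => (orderedPow (multMatrix α ν) γ).mulVec (Pi.single 0 1) i)
        (map (algebraMap K ℂ) p) := by
  set φ : PolyXMu K α →ₐ[K] ℂ := aeval (Sum.elim ξ ν) with hφ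
  have hmat (γ : Fin n →₀ ℕ) : (φ : PolyXMu K α →+* ℂ)
      ((orderedPow (parMatrix K α) γ).mulVec (Pi.single 0 1) i) =
      (orderedPow (multMatrix α ν) γ).mulVec (Pi.single 0 1) i := by
    rw [Matrix.mulVec_single_one, Matrix.mulVec_single_one, Matrix.col_apply, Matrix.col_apply]
    have h1 := map_orderedPow (φ : PolyXMu K α →+* ℂ).mapMatrix (parMatrix K α) γ
    have h2 (j : Fin n) : (φ : PolyXMu K α →+* ℂ).mapMatrix (parMatrix K α j) =
        multMatrix α ν j := by
      rw [parMatrix, multMatrix_map]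
      simp [hφ]
    simp only [h2] at h1
    rw [← h1]
    rfl
  have hcoef (γ : Fin n →₀ ℕ) : φ (C ((multiFactorial γ : K)⁻¹) *
      rename Sum.inl (iterDeriv K γ p)) = coeff γ (translate ξ (map (algebraMap K ℂ) p)) := by
    rw [map_mul, hφ, aeval_rename, Sum.elim_comp_inl, algHom_C]
    rw [← aeval_map_algebraMap ℂ ξ (iterDeriv K γ p), map_iterDeriv, aeval_iterDeriv, map_inv₀,
      map_natCast, ← mul_assoc, inv_mul_cancel₀ (multiFactorial_ne_zero γ), one_mul]
  have hfin : (Function.support fun γ : Fin n →₀ ℕ =>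
      (C ((multiFactorial γ : K)⁻¹) * rename Sum.inl (iterDeriv K γ p) : PolyXMu K α) •
        (orderedPow (parMatrix K α) γ).mulVec (Pi.single 0 1)).Finite := by
    refine (finite_iterDeriv_ne_zero p).subset fun γ hγ h0 => hγ ?_
    simp [h0]
  let T : (Fin (d + 1) → PolyXMu K α) →+ ℂ :=
    (φ : PolyXMu K α →+* ℂ).toAddMonoidHom.comp (Pi.evalAddMonoidHom _ i)
  have hT := T.map_finsum hfin
  change φ (normalForm α p i) = _ at hT
  rw [hT, momentFunctional_apply]
  refine finsum_congr fun γ => ?_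
  change φ (_ * _) = _
  rw [map_mul, hcoef]
  exact congrArg _ (hmat γ)

lemma mem_zeroLocus_deflatedIdeal {N : ℕ} (K : Subfield ℂ) {α : Fin (d + 1) → (Fin n →₀ ℕ)}
    (hα : IsExponentSet α) (f : Fin N → MvPolynomial (Fin n) K) (ξ : Fin n → ℂ)
    (ν : Var α → ℂ) :
    Sum.elim ξ ν ∈ zeroLocus ℂ (deflatedIdeal α f) ↔
      ∃ w, IsMultSeq α ν w ∧
        ∀ k i, momentFunctional ξ (fun γ => w γ i) (map (algebraMap K ℂ) (f k)) = 0 := by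
  set φ : PolyXMu K α →ₐ[K] ℂ := aeval (Sum.elim ξ ν) with hφ
  have hpar (i : Fin n) : (φ : PolyXMu K α →+* ℂ).mapMatrix (parMatrix K α i) =
      multMatrix α ν i := by
    rw [parMatrix, multMatrix_map]
    simp [hφ]
  have hcomm (i j : Fin n) (a b : Fin (d + 1)) :
      φ ((parMatrix K α i * parMatrix K α j - parMatrix K α j * parMatrix K α i) a b) =
      (multMatrix α ν i * multMatrix α ν j - multMatrix α ν j * multMatrix α ν i) a b := by
    rw [← hpar, ← hpar, ← map_mul, ← map_mul, ← map_sub]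
    rfl
  have hker : Sum.elim ξ ν ∈ zeroLocus ℂ (deflatedIdeal α f) ↔
      deflatedIdeal α f ≤ RingHom.ker φ := Iff.rfl
  rw [hker, deflatedIdeal, sup_le_iff, Ideal.span_le, Ideal.span_le]
  constructor
  · rintro ⟨h1, h2⟩
    have hM : ∀ i j, Commute (multMatrix α ν i) (multMatrix α ν j) := by
      intro i j
      ext a b
      rw [← sub_eq_zero, ← Matrix.sub_apply, ← hcomm]
      exact h2 ⟨i, j, a, b, rfl⟩
    refine ⟨_, IsMultSeq.orderedPow hM, fun k i => ?_⟩
    rw [← aeval_normalForm]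
    exact h1 ⟨k, i, rfl⟩
  · rintro ⟨w, hw, hf⟩
    have hM := hw.commute hα
    have hw' := hw.unique (IsMultSeq.orderedPow hM)
    subst hw'
    constructor
    · rintro _ ⟨k, i, rfl⟩
      exact (aeval_normalForm K α ξ ν (f k) i).trans (hf k i)
    · rintro _ ⟨i, j, a, b, rfl⟩
      refine (hcomm i j a b).trans ?_
      rw [(hM i j).eq, sub_self, Matrix.zero_apply]

/-! ### The maximal ideal at a point -/

lemma maxIdealAt_eq_ker (ξ : Fin n → ℂ) :
    maxIdealAt ξ = RingHom.ker (aeval ξ : MvPolynomial (Fin n) ℂ →ₐ[ℂ] ℂ) := by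
  apply le_antisymm
  · rw [maxIdealAt, Ideal.span_le]
    rintro _ ⟨j, rfl⟩
    simp [RingHom.mem_ker]
  · intro p hp
    have h : (Ideal.Quotient.mkₐ ℂ (maxIdealAt ξ)) =
        (Algebra.ofId ℂ (MvPolynomial (Fin n) ℂ ⧸ maxIdealAt ξ)).comp (aeval ξ) := by
      ext j : 1
      rw [AlgHom.comp_apply, aeval_X, Algebra.ofId_apply, Ideal.Quotient.mkₐ_eq_mk,
        ← Ideal.Quotient.mk_algebraMap, Ideal.Quotient.eq]
      exact Ideal.subset_span ⟨j, rfl⟩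
    rw [← Ideal.Quotient.eq_zero_iff_mem, ← Ideal.Quotient.mkₐ_eq_mk ℂ, h, AlgHom.comp_apply,
      (RingHom.mem_ker).1 hp, map_zero]

/-- Each component not contained in 𝔪_ξ has an element outside 𝔪_ξ. The product of these elements
avoids the prime 𝔪_ξ and puts `p` into the discarded components; the other components contribute the
factor 1 or another element outside 𝔪_ξ. -/
lemma interBelow_mul_mem {J : Ideal (MvPolynomial (Fin n) ℂ)}
    {t : Finset (Ideal (MvPolynomial (Fin n) ℂ))} (ht : t.inf id ≤ J) (ξ : Fin n → ℂ)
    {p : MvPolynomial (Fin n) ℂ} (hp : p ∈ interBelow t ξ) :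
    ∃ s ∉ maxIdealAt ξ, s * p ∈ J := by
  classical
  have hprime : (maxIdealAt ξ).IsPrime := by
    rw [maxIdealAt_eq_ker]; exact RingHom.ker_isPrime _
  have hs : ∀ L : Ideal (MvPolynomial (Fin n) ℂ), ∃ s, s ∉ maxIdealAt ξ ∧
      (¬ L ≤ maxIdealAt ξ → s ∈ L) := by
    intro L
    by_cases hL : L ≤ maxIdealAt ξ
    · exact ⟨1, (Ideal.ne_top_iff_one _).1 hprime.ne_top, fun h => absurd hL h⟩
    · obtain ⟨s, hs, hs'⟩ := Set.not_subset.1 hL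
      exact ⟨s, hs', fun _ => hs⟩
  choose s hs hs' using hs
  refine ⟨∏ L ∈ t, s L, ?_, ht ?_⟩
  · rw [hprime.prod_mem_iff]
    rintro ⟨L, -, hL⟩
    exact hs L hL
  · rw [Submodule.mem_finsetInf]
    intro L hL
    by_cases hLm : L ≤ maxIdealAt ξ
    · refine Ideal.mul_mem_left _ _ ?_
      rw [interBelow, Submodule.mem_finsetInf] at hp
      exact hp L (by simp [hL, hLm])
    · refine Ideal.mul_mem_right _ _ ?_
      exact Ideal.mem_of_dvd _ (Finset.dvd_prod_of_mem s hL) (hs' L hLm)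

lemma le_interBelow (t : Finset (Ideal (MvPolynomial (Fin n) ℂ))) (ξ : Fin n → ℂ) :
    t.inf id ≤ interBelow t ξ := by
  classical
  rw [interBelow]
  exact Finset.le_inf fun L hL => Finset.inf_le (Finset.mem_of_mem_filter L hL)

lemma shiftedMonomial_mem_pow (ξ : Fin n → ℂ) (γ : Fin n →₀ ℕ) :
    shiftedMonomial ξ γ ∈ maxIdealAt ξ ^ γ.degree := by
  induction γ using exponent_induction with
  | zero => simp
  | add γ j h =>
    rw [shiftedMonomial_add_single, map_add, Finsupp.degree_single, pow_succ']
    exact Ideal.mul_mem_mul (Ideal.subset_span ⟨j, rfl⟩) h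

/-! ### The ideal defined by a sequence generated by the multiplication matrices -/

lemma mul_mem_of_forall_mul_X_sub_C {P : Submodule ℂ (MvPolynomial (Fin n) ℂ)} (ξ : Fin n → ℂ)
    (h : ∀ j, ∀ p ∈ P, (X j - C (ξ j)) * p ∈ P) (q : MvPolynomial (Fin n) ℂ) :
    ∀ p ∈ P, q * p ∈ P := by
  induction q using MvPolynomial.induction_on with
  | C a => exact fun p hp => by rw [C_mul']; exact P.smul_mem a hp
  | add q r hq hr => exact fun p hp => by rw [add_mul]; exact P.add_mem (hq p hp) (hr p hp)
  | mul_X q j hq =>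
    intro p hp
    have : q * X j * p = q * ((X j - C (ξ j)) * p) + q * (ξ j • p) := by
      rw [← C_mul']; ring
    rw [this]
    exact P.add_mem (hq _ (h j p hp)) (hq _ (P.smul_mem _ hp))

namespace IsMultSeq

variable {α : Fin (d + 1) → (Fin n →₀ ℕ)} {μ : Var α → ℂ}
  {w : (Fin n →₀ ℕ) → Fin (d + 1) → ℂ}

/-- Multiplication by `xⱼ - ξⱼ` shifts the moments by `eⱼ`, which is the recursion for `w`. -/
lemma functional_mul (hw : IsMultSeq α μ w) (ξ : Fin n → ℂ) (i : Fin (d + 1)) (j : Fin n)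
    (p : MvPolynomial (Fin n) ℂ) :
    momentFunctional ξ (fun γ => w γ i) ((X j - C (ξ j)) * p) =
      ∑ k, multMatrix α μ j i k * momentFunctional ξ (fun γ => w γ k) p := by
  have : momentFunctional ξ (fun γ => w γ i) ∘ₗ LinearMap.mulLeft ℂ (X j - C (ξ j)) =
      ∑ k, multMatrix α μ j i k • momentFunctional ξ (fun γ => w γ k) := by
    refine linearMap_ext_shiftedMonomial ξ fun γ => ?_
    rw [LinearMap.comp_apply, LinearMap.mulLeft_apply, ← shiftedMonomial_add_single,
      momentFunctional_shiftedMonomial, hw.add_single, LinearMap.sum_apply]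
    simp only [LinearMap.smul_apply, momentFunctional_shiftedMonomial, smul_eq_mul]
    rfl
  have h := DFunLike.congr_fun this p
  rw [LinearMap.sum_apply] at h
  exact h

/-- The polynomials killed by the functionals `Λᵢ` with `|αᵢ| < m`. -/
def annIdeal (hw : IsMultSeq α μ w) (ξ : Fin n → ℂ) (m : ℕ) :
    Ideal (MvPolynomial (Fin n) ℂ) where
  carrier := {p | ∀ i, (α i).degree < m → momentFunctional ξ (fun γ => w γ i) p = 0}
  add_mem' hp hq i hi := by rw [map_add, hp i hi, hq i hi, add_zero]
  zero_mem' i _ := map_zero _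
  smul_mem' q p hp := by
    let P : Submodule ℂ (MvPolynomial (Fin n) ℂ) :=
      ⨅ (i) (_ : (α i).degree < m), LinearMap.ker (momentFunctional ξ fun γ => w γ i)
    have hP (p) : p ∈ P ↔ ∀ i, (α i).degree < m → momentFunctional ξ (fun γ => w γ i) p = 0 := by
      simp [P, Submodule.mem_iInf]
    refine (hP _).1 (mul_mem_of_forall_mul_X_sub_C ξ (fun j p hp => ?_) q p ((hP p).2 hp))
    rw [hP] at hp ⊢
    intro i hi
    rw [hw.functional_mul]
    refine Finset.sum_eq_zero fun k _ => ?_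
    by_cases hk : (α i).degree ≤ (α k).degree
    · rw [multMatrix_eq_zero_of_degree_le hk, zero_mul]
    · rw [hp k (by omega), mul_zero]

/-- By strict triangularity, Λᵢ((xⱼ - ξⱼ) p) involves only functionals Λₖ with |αₖ| < |αᵢ|. -/
lemma maxIdealAt_mul_annIdeal_le (hw : IsMultSeq α μ w) (ξ : Fin n → ℂ) (m : ℕ) :
    maxIdealAt ξ * hw.annIdeal ξ m ≤ hw.annIdeal ξ (m + 1) := by
  rw [Ideal.mul_le]
  intro r hr p hp
  induction hr using Submodule.span_induction with
  | mem r hr =>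
    obtain ⟨j, rfl⟩ := hr
    intro i hi
    rw [hw.functional_mul]
    refine Finset.sum_eq_zero fun k _ => ?_
    by_cases hk : (α i).degree ≤ (α k).degree
    · rw [multMatrix_eq_zero_of_degree_le hk, zero_mul]
    · rw [hp k (by omega), mul_zero]
  | zero => rw [zero_mul]; exact Ideal.zero_mem _
  | add r s _ _ hr hs => rw [add_mul]; exact Ideal.add_mem _ hr hs
  | smul a r _ hr => rw [smul_eq_mul, mul_assoc]; exact Ideal.mul_mem_left _ _ hr

lemma maxIdealAt_pow_le (hw : IsMultSeq α μ w) (ξ : Fin n → ℂ) (m : ℕ) :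
    maxIdealAt ξ ^ m ≤ hw.annIdeal ξ m := by
  induction m with
  | zero => exact fun p _ i hi => absurd hi (Nat.not_lt_zero _)
  | succ m ih =>
    rw [pow_succ']
    exact (Ideal.mul_mono_right ih).trans (hw.maxIdealAt_mul_annIdeal_le ξ m)

lemma annIdeal_anti (hw : IsMultSeq α μ w) (ξ : Fin n → ℂ) {m m' : ℕ} (h : m ≤ m') :
    hw.annIdeal ξ m' ≤ hw.annIdeal ξ m := fun _ hp i hi => hp i (hi.trans_le h)

/-- Polynomials that do not vanish at `ξ` are units modulo `annIdeal`. -/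
lemma mem_annIdeal_of_mul_mem (hw : IsMultSeq α μ w) {ξ : Fin n → ℂ} {m : ℕ}
    {s p : MvPolynomial (Fin n) ℂ} (hs : s ∉ maxIdealAt ξ) (h : s * p ∈ hw.annIdeal ξ m) :
    p ∈ hw.annIdeal ξ m := by
  have hs0 : aeval ξ s ≠ 0 := by
    rwa [maxIdealAt_eq_ker, RingHom.mem_ker] at hs
  have hr : s - C (aeval ξ s) ∈ maxIdealAt ξ := by
    rw [maxIdealAt_eq_ker, RingHom.mem_ker, map_sub]
    simp [algHom_C]
  -- Split `s` as `s(ξ)` plus an element of 𝔪_ξ. The second part carries `p` from level `k` to level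
  -- `k + 1`, so `s(ξ) p` reaches level `k + 1`, and `s(ξ)` is invertible.
  have key : ∀ k ≤ m, p ∈ hw.annIdeal ξ k := by
    intro k
    induction k with
    | zero => exact fun _ i hi => absurd hi (Nat.not_lt_zero _)
    | succ k ih =>
      intro hk
      have h1 : (s - C (aeval ξ s)) * p ∈ hw.annIdeal ξ (k + 1) :=
        hw.maxIdealAt_mul_annIdeal_le ξ k (Ideal.mul_mem_mul hr (ih (by omega)))
      have h2 := Ideal.sub_mem _ (hw.annIdeal_anti ξ hk h) h1
      have h3 := Ideal.mul_mem_left _ (C (aeval ξ s)⁻¹) h2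
      have h4 : (C (aeval ξ s)⁻¹ * (s * p - (s - C (aeval ξ s)) * p) :
          MvPolynomial (Fin n) ℂ) = p := by
        rw [← sub_mul, sub_sub_cancel, ← mul_assoc, ← C_mul, inv_mul_cancel₀ hs0, C_1, one_mul]
      rwa [h4] at h3
  exact key m le_rfl

/-- The common kernel of the functionals `p ↦ ∑_γ (1 / γ!) ∂^γ(p)(ξ) (w γ)ᵢ`. -/
def kerIdeal (hw : IsMultSeq α μ w) (ξ : Fin n → ℂ) : Ideal (MvPolynomial (Fin n) ℂ) :=
  hw.annIdeal ξ ((α (Fin.last d)).degree + 1)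

/-- The strict bound `o + 1` excludes no functional, because the last exponent has the largest
degree. -/
lemma mem_kerIdeal (hα : IsExponentSet α) (hw : IsMultSeq α μ w) {ξ : Fin n → ℂ}
    {p : MvPolynomial (Fin n) ℂ} : p ∈ hw.kerIdeal ξ ↔
      ∀ i, momentFunctional ξ (fun γ => w γ i) p = 0 :=
  forall_congr' fun i => forall_prop_of_true (Nat.lt_succ_of_le (hα.monotone (Fin.le_last i)))

/-- The functionals are dual to the monomials `(x - ξ)^αₖ`, so the sum interpolates `p`. -/
lemma sub_sum_mem_kerIdeal (hα : IsExponentSet α) (hw : IsMultSeq α μ w) (ξ : Fin n → ℂ)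
    (p : MvPolynomial (Fin n) ℂ) :
    p - ∑ k, momentFunctional ξ (fun γ => w γ k) p • shiftedMonomial ξ (α k) ∈
      hw.kerIdeal ξ := by
  rw [hw.mem_kerIdeal hα]
  intro i
  simp [hw.apply_exponent hα, Pi.single_apply]

lemma functional_eq_sum_of_kerIdeal (hα : IsExponentSet α) (hw : IsMultSeq α μ w) (ξ : Fin n → ℂ)
    (F : Module.Dual ℂ (MvPolynomial (Fin n) ℂ)) (hF : ∀ p ∈ hw.kerIdeal ξ, F p = 0) :
    F = ∑ k, F (shiftedMonomial ξ (α k)) • momentFunctional ξ (fun γ => w γ k) := by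
  refine LinearMap.ext fun p => ?_
  have h := hF _ (hw.sub_sum_mem_kerIdeal hα ξ p)
  rw [map_sub, sub_eq_zero] at h
  rw [h, map_sum, LinearMap.sum_apply]
  refine Finset.sum_congr rfl fun k _ => ?_
  rw [map_smul, LinearMap.smul_apply, smul_eq_mul, smul_eq_mul, mul_comm]

/-- As `α₀ = 0`, the moments of positive degree vanish. This makes `ξ` a root of `I`. -/
lemma functional_zero (hα : IsExponentSet α) (hw : IsMultSeq α μ w) (ξ : Fin n → ℂ) :
    momentFunctional ξ (fun γ => w γ 0) = (aeval ξ).toLinearMap := by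
  refine linearMap_ext_shiftedMonomial ξ fun γ => ?_
  rw [momentFunctional_shiftedMonomial, AlgHom.toLinearMap_apply]
  by_cases hγ : γ = 0
  · simp [hγ, hw.zero, shiftedMonomial_zero]
  · rw [hw.apply_eq_zero]
    · obtain ⟨j, hj⟩ := Finsupp.ne_iff.1 hγ
      rw [shiftedMonomial, map_prod, eq_comm]
      exact Finset.prod_eq_zero (Finset.mem_univ j) (by simpa using hj)
    · rw [hα.zero, map_zero]
      exact Nat.pos_of_ne_zero fun h => hγ ((Finsupp.degree_eq_zero_iff γ).1 h)

end IsMultSeq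

/-! ### Deformations of the multiplication matrices -/

/-- Nakayama by iteration: nilpotence of `m` modulo `Q` replaces finite generation. -/
lemma ideal_le_of_le_mul_sup {R : Type*} [CommRing R] {m J Q : Ideal R} (h : J ≤ m * J ⊔ Q)
    {k : ℕ} (hk : m ^ k ≤ Q) : J ≤ Q := by
  have key (l : ℕ) : J ≤ m ^ l ⊔ Q := by
    induction l with
    | zero => simp
    | succ l ih =>
      refine h.trans (sup_le ?_ le_sup_right)
      rw [pow_succ']
      refine (Ideal.mul_mono_right ih).trans ?_
      rw [Ideal.mul_sup]
      exact sup_le_sup_left Ideal.mul_le_right _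
  exact (key k).trans (sup_le hk le_rfl)

namespace IsMultSeq

variable {α : Fin (d + 1) → (Fin n →₀ ℕ)} {μ : Var α → ℂ}
  {w : (Fin n →₀ ℕ) → Fin (d + 1) → ℂ}

/-- If `Q` is strictly smaller than the common kernel, the dual space of `Q` contains an element
outside the span of the given functionals whose derivatives lie in that span. -/
lemma exists_moments (hα : IsExponentSet α) (hw : IsMultSeq α μ w) {ξ : Fin n → ℂ}
    {Q : Ideal (MvPolynomial (Fin n) ℂ)} (hQ : Q ≤ hw.kerIdeal ξ)
    (hm : maxIdealAt ξ ^ ((α (Fin.last d)).degree + 1) ≤ Q) (hne : ¬ hw.kerIdeal ξ ≤ Q) :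
    ∃ c : (Fin n →₀ ℕ) → ℂ, c ≠ 0 ∧ (∀ p ∈ Q, momentFunctional ξ c p = 0) ∧
      (∀ γ, (α (Fin.last d)).degree < γ.degree → c γ = 0) ∧ (∀ k, c (α k) = 0) ∧
      ∀ γ j, c (γ + Finsupp.single j 1) = ∑ k, c (α k + Finsupp.single j 1) * w γ k := by
  set J : Ideal (MvPolynomial (Fin n) ℂ) := maxIdealAt ξ * hw.kerIdeal ξ ⊔ Q with hJ
  have hJker : J ≤ hw.kerIdeal ξ := sup_le Ideal.mul_le_right hQ
  obtain ⟨p, hp, hpJ⟩ : ∃ p ∈ hw.kerIdeal ξ, p ∉ J :=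
    Set.not_subset.1 fun h => hne (ideal_le_of_le_mul_sup h hm)
  obtain ⟨F, hFp, hFJ⟩ := Submodule.exists_le_ker_of_notMem (p := J.restrictScalars ℂ) hpJ
  -- The correction makes the functional vanish at the monomials with exponents in `E` without
  -- changing it on the common kernel.
  let G : Module.Dual ℂ (MvPolynomial (Fin n) ℂ) :=
    F - ∑ k, F (shiftedMonomial ξ (α k)) • momentFunctional ξ (fun γ => w γ k)
  have hG (q) (hq : q ∈ hw.kerIdeal ξ) : G q = F q := by
    simp only [G, LinearMap.sub_apply, LinearMap.sum_apply, LinearMap.smul_apply]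
    rw [Finset.sum_eq_zero, sub_zero]
    intro k _
    rw [(hw.mem_kerIdeal hα).1 hq k, smul_zero]
  have hGJ (q) (hq : q ∈ J) : G q = 0 := (hG q (hJker hq)).trans (hFJ hq)
  have hGc : momentFunctional ξ (fun γ => G (shiftedMonomial ξ γ)) = G :=
    linearMap_ext_shiftedMonomial ξ fun γ => by rw [momentFunctional_shiftedMonomial]
  refine ⟨fun γ => G (shiftedMonomial ξ γ), fun h0 => hFp ?_, fun q hq => ?_, fun γ hγ => ?_,
    fun k => ?_, fun γ j => ?_⟩
  · rw [← hG p hp, ← hGc, h0, show momentFunctional ξ (0 : (Fin n →₀ ℕ) → ℂ) = 0 from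
      linearMap_ext_shiftedMonomial ξ fun γ => by simp, LinearMap.zero_apply]
  · rw [hGc]
    exact hGJ q (le_sup_right (a := maxIdealAt ξ * hw.kerIdeal ξ) hq)
  · refine hGJ _ (le_sup_right (a := maxIdealAt ξ * hw.kerIdeal ξ) (hm ?_))
    exact Ideal.pow_le_pow_right hγ (shiftedMonomial_mem_pow ξ γ)
  · simp [G, hw.apply_exponent hα, Pi.single_apply]
  -- Composing `G` with multiplication by `xⱼ - ξⱼ` kills the common kernel, because `J` contains
  -- 𝔪_ξ times that kernel; so the result is a combination of the Λₖ.
  · have h := hw.functional_eq_sum_of_kerIdeal hα ξ (G ∘ₗ LinearMap.mulLeft ℂ (X j - C (ξ j)))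
      fun q hq => hGJ _ (le_sup_left (b := Q)
        (Ideal.mul_mem_mul (Ideal.subset_span ⟨j, rfl⟩) hq))
    have h2 := DFunLike.congr_fun h (shiftedMonomial ξ γ)
    simp only [LinearMap.comp_apply, LinearMap.mulLeft_apply, ← shiftedMonomial_add_single,
      LinearMap.sum_apply, LinearMap.smul_apply, momentFunctional_shiftedMonomial,
      smul_eq_mul] at h2
    exact h2

/-- Only the last row of each matrix and the last coordinate of `w` change. Terms quadratic in `s`
would pair the last column with the last coordinate, but that column stays zero because `αᵢ` of
maximal degree comes last. The terms linear in `s` are `hrec`. -/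
lemma deform (hα : IsExponentSet α) (hw : IsMultSeq α μ w) {c : (Fin n →₀ ℕ) → ℂ}
    (hdeg : ∀ γ, (α (Fin.last d)).degree < γ.degree → c γ = 0) (hE : ∀ k, c (α k) = 0)
    (hrec : ∀ γ j, c (γ + Finsupp.single j 1) = ∑ k, c (α k + Finsupp.single j 1) * w γ k)
    (s : ℂ) :
    IsMultSeq α (fun v => μ v + s * if v.1.1 = Fin.last d then c v.1.2 else 0)
      fun γ i => w γ i + s * if i = Fin.last d then c γ else 0 := by
  have hmat (i k : Fin (d + 1)) (j : Fin n) :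
      multMatrix α (fun v => μ v + s * if v.1.1 = Fin.last d then c v.1.2 else 0) j i k =
        multMatrix α μ j i k + s * if i = Fin.last d then c (α k + Finsupp.single j 1) else 0 := by
    rw [← hw.apply_border hα i k j]
    refine (eq_multMatrix hα i
      (fun γ => w γ i + s * if i = Fin.last d then c γ else 0) ?_ ?_ ?_ k j).symm
    · intro l
      simp [hw.apply_exponent hα, Pi.single_apply, hE]
    · rintro ⟨⟨i', β⟩, hv⟩ rfl
      obtain ⟨k, j, hβ, -⟩ := id hv.2
      change β = _ at hβ
      subst hβ
      change w _ i' + _ = _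
      rw [hw.apply_border hα, multMatrix_eq_var hv]
    · intro γ hγ
      rw [hw.apply_eq_zero γ i hγ]
      split_ifs with hi
      · rw [hdeg γ (hi ▸ hγ), mul_zero, add_zero]
      · simp
  have hlast (j : Fin n) : c (α (Fin.last d) + Finsupp.single j 1) = 0 :=
    hdeg _ (by rw [map_add, Finsupp.degree_single]; omega)
  constructor
  · funext i
    have h0 : c 0 = 0 := by rw [← hα.zero]; exact hE 0
    simp [hw.zero, h0]
  · intro γ j
    funext i
    have hcol : multMatrix α μ j i (Fin.last d) = 0 :=
      multMatrix_eq_zero_of_degree_le (hα.monotone (Fin.le_last i))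
    simp only [Matrix.mulVec, dotProduct, hmat]
    have hterm (k : Fin (d + 1)) :
        (multMatrix α μ j i k + s * if i = Fin.last d then c (α k + Finsupp.single j 1) else 0) *
          (w γ k + s * if k = Fin.last d then c γ else 0) =
        multMatrix α μ j i k * w γ k +
          s * ((if i = Fin.last d then c (α k + Finsupp.single j 1) else 0) * w γ k) := by
      by_cases hk : k = Fin.last d
      · subst hk
        simp [hcol, hlast]
      · simp only [hk, if_false, mul_zero, add_zero]
        ring
    rw [Finset.sum_congr rfl fun k _ => hterm k, Finset.sum_add_distrib, ← Finset.mul_sum,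
      hw.add_single, Matrix.mulVec, dotProduct]
    congr 2
    split_ifs with hi
    · exact hrec γ j
    · simp

/-- Ensures that the deformation really moves the point: by `hrec`, `c` is determined by its values
at the exponents `αₖ + eⱼ`, and these vanish unless they belong to variables of the last row. -/
lemma exists_var_ne_zero (hα : IsExponentSet α) {c : (Fin n →₀ ℕ) → ℂ} (hc : c ≠ 0)
    (hdeg : ∀ γ, (α (Fin.last d)).degree < γ.degree → c γ = 0) (hE : ∀ k, c (α k) = 0)
    (hrec : ∀ γ j, c (γ + Finsupp.single j 1) = ∑ k, c (α k + Finsupp.single j 1) * w γ k) :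
    ∃ v : Var α, v.1.1 = Fin.last d ∧ c v.1.2 ≠ 0 := by
  by_contra! h
  have hborder (k : Fin (d + 1)) (j : Fin n) : c (α k + Finsupp.single j 1) = 0 := by
    by_contra hne
    have hle : (α k + Finsupp.single j 1).degree ≤ (α (Fin.last d)).degree := by
      by_contra! hlt
      exact hne (hdeg _ hlt)
    rw [map_add, Finsupp.degree_single] at hle
    have hv : IsVar α (Fin.last d, α k + Finsupp.single j 1) := by
      refine ⟨?_, k, j, rfl, hle⟩
      rintro ⟨l, hl⟩
      exact hne ((congrArg c hl).symm.trans (hE l))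
    exact hne (h ⟨_, hv⟩ rfl)
  refine hc (funext fun γ => ?_)
  induction γ using exponent_induction with
  | zero => rw [← hα.zero]; exact hE 0
  | add γ j _ => rw [hrec]; simp [hborder]

end IsMultSeq

/-- At an isolated zero of the deflated ideal the common kernel of the dual functionals is as small
as possible. -/
lemma kerIdeal_le_of_isIsolatedIn {N : ℕ} (K : Subfield ℂ) {α : Fin (d + 1) → (Fin n →₀ ℕ)}
    (hα : IsExponentSet α) (f : Fin N → MvPolynomial (Fin n) K) {ξ : Fin n → ℂ}
    {ν : Var α → ℂ}
    (hiso : IsIsolatedIn (zeroLocus ℂ (deflatedIdeal α f)) (Sum.elim ξ ν))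
    {w : (Fin n →₀ ℕ) → Fin (d + 1) → ℂ} (hw : IsMultSeq α ν w)
    {Q : Ideal (MvPolynomial (Fin n) ℂ)} (hQ : Q ≤ hw.kerIdeal ξ)
    (hf : ∀ k, map (algebraMap K ℂ) (f k) ∈ Q)
    (hm : maxIdealAt ξ ^ ((α (Fin.last d)).degree + 1) ≤ Q) : hw.kerIdeal ξ ≤ Q := by
  by_contra hne
  obtain ⟨c, hc, hcQ, hdeg, hE, hrec⟩ := hw.exists_moments hα hQ hm hne
  obtain ⟨v, hv, hcv⟩ := IsMultSeq.exists_var_ne_zero hα hc hdeg hE hrec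
  obtain ⟨U, hU, hVU⟩ := hiso
  let path : ℂ → (Fin n ⊕ Var α → ℂ) := fun s =>
    Sum.elim ξ fun v => ν v + s * if v.1.1 = Fin.last d then c v.1.2 else 0
  have hpath (s : ℂ) : path s ∈ zeroLocus ℂ (deflatedIdeal α f) := by
    refine (mem_zeroLocus_deflatedIdeal K hα f ξ _).2
      ⟨_, hw.deform hα hdeg hE hrec s, fun k i => ?_⟩
    have hsplit : momentFunctional ξ
        (fun γ => w γ i + s * if i = Fin.last d then c γ else 0) =
        momentFunctional ξ (fun γ => w γ i) +
          (s * if i = Fin.last d then 1 else 0) • momentFunctional ξ c :=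
      linearMap_ext_shiftedMonomial ξ fun γ => by by_cases hi : i = Fin.last d <;> simp [hi]
    rw [hsplit, LinearMap.add_apply, LinearMap.smul_apply, hcQ _ (hf k), smul_zero, add_zero]
    exact (hw.mem_kerIdeal hα).1 (hQ (hf k)) i
  have hcont : Continuous path := by
    refine continuous_pi fun a => ?_
    rcases a with a | a
    · exact continuous_const
    · exact continuous_const.add (continuous_id.mul continuous_const)
  have h0 : path 0 = Sum.elim ξ ν := by simp [path]
  have hmem : Sum.elim ξ ν ∈ U := by
    have : Sum.elim ξ ν ∈ zeroLocus ℂ (deflatedIdeal α f) ∩ U := by rw [hVU]; rfl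
    exact this.2
  -- The punctured neighbourhood filter of 0 in ℂ is nontrivial, so it supplies some `s ≠ 0` whose
  -- point on the line lies in `U`.
  have hnear : ∀ᶠ s in nhdsWithin (0 : ℂ) {0}ᶜ, path s ∈ U :=
    (hcont.continuousAt.eventually (by rw [h0]; exact hU.mem_nhds hmem)).filter_mono
      nhdsWithin_le_nhds
  obtain ⟨s, hsU, hs⟩ := (hnear.and self_mem_nhdsWithin).exists
  have hs2 : path s ∈ ({Sum.elim ξ ν} : Set _) := hVU ▸ ⟨hpath s, hsU⟩
  have h3 := congrFun (Set.mem_singleton_iff.1 hs2) (Sum.inr v)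
  simp only [path, Sum.elim_inr, hv, if_true, add_eq_left, mul_eq_zero, hcv, or_false] at h3
  exact hs h3

/-! ### The dual basis -/

lemma totalDegree_le_of_dualCoeff {Λ : MvPolynomial (Fin n) ℂ} {m : ℕ}
    (h : ∀ γ, m < γ.degree → dualCoeff Λ γ = 0) : Λ.totalDegree ≤ m := by
  refine Finset.sup_le fun γ hγ => ?_
  by_contra! hlt
  exact mem_support_iff.1 hγ ((mul_eq_zero.1 (h γ hlt)).resolve_left (multiFactorial_ne_zero γ))

lemma dualCoeff_eq_zero_of_totalDegree_lt {Λ : MvPolynomial (Fin n) ℂ} {γ : Fin n →₀ ℕ}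
    (h : Λ.totalDegree < γ.degree) : dualCoeff Λ γ = 0 := by
  rw [dualCoeff, coeff_eq_zero_of_totalDegree_lt h, mul_zero]

lemma dualCoeff_add (Λ Λ' : MvPolynomial (Fin n) ℂ) (γ : Fin n →₀ ℕ) :
    dualCoeff (Λ + Λ') γ = dualCoeff Λ γ + dualCoeff Λ' γ := by
  rw [dualCoeff, coeff_add, mul_add, dualCoeff, dualCoeff]

lemma dualCoeff_monomial_inv (β γ : Fin n →₀ ℕ) (a : ℂ) :
    dualCoeff (monomial β (a * (multiFactorial β : ℂ)⁻¹)) γ = if β = γ then a else 0 := by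
  rw [dualCoeff, coeff_monomial]
  split_ifs with h
  · subst h
    rw [mul_comm, mul_assoc, inv_mul_cancel₀ (multiFactorial_ne_zero β), mul_one]
  · rw [mul_zero]

lemma dualCoeff_finsuppSum (c : (Fin n →₀ ℕ) →₀ ℂ) (γ : Fin n →₀ ℕ) :
    dualCoeff (c.sum fun β a => monomial β (a * (multiFactorial β : ℂ)⁻¹)) γ = c γ := by
  classical
  rw [dualCoeff, Finsupp.sum, coeff_sum, Finset.mul_sum]
  change ∑ β ∈ c.support, dualCoeff _ γ = _
  simp only [dualCoeff_monomial_inv]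
  rw [Finset.sum_ite_eq']
  simp +contextual [eq_comm]

/-- The element of `ℂ[∂_ξ]` with coefficients `c γ / γ!` at the `∂^γ` with `|γ| ≤ m`. -/
def truncatedDual (m : ℕ) (c : (Fin n →₀ ℕ) → ℂ) : MvPolynomial (Fin n) ℂ :=
  (Finsupp.onFinset (Finsupp.finite_of_degree_le m).toFinset
    (fun γ => if γ.degree ≤ m then c γ else 0) (by simp +contextual)).sum
      fun β a => monomial β (a * (multiFactorial β : ℂ)⁻¹)

lemma dualCoeff_truncatedDual {m : ℕ} {c : (Fin n →₀ ℕ) → ℂ}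
    (hc : ∀ γ, m < γ.degree → c γ = 0) (γ : Fin n →₀ ℕ) :
    dualCoeff (truncatedDual m c) γ = c γ := by
  rw [truncatedDual, dualCoeff_finsuppSum, Finsupp.onFinset_apply]
  split_ifs with h
  · rfl
  · exact (hc γ (not_le.1 h)).symm

namespace IsMultSeq

variable {α : Fin (d + 1) → (Fin n →₀ ℕ)} {μ : Var α → ℂ}
  {w : (Fin n →₀ ℕ) → Fin (d + 1) → ℂ}

/-- A family with the given dual coefficients is part of a normalized pair for the common kernel. -/
lemma isNormalizedPair (hα : IsExponentSet α) (hw : IsMultSeq α μ w) (ξ : Fin n → ℂ)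
    {Λ : Fin (d + 1) → MvPolynomial (Fin n) ℂ} (hΛ : ∀ i γ, dualCoeff (Λ i) γ = w γ i) :
    IsNormalizedPair α ξ (hw.kerIdeal ξ) (fun i => shiftedMonomial ξ (α i)) Λ := by
  have hfun (i) : diffFunctional ξ (Λ i) = momentFunctional ξ fun γ => w γ i := by
    rw [diffFunctional_eq_momentFunctional, funext (hΛ i)]
  have hE (i k) : dualCoeff (Λ i) (α k) = if i = k then 1 else 0 := by
    rw [hΛ, hw.apply_exponent hα, Pi.single_apply]
  have hdegree (i) : (Λ i).totalDegree = (α i).degree := by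
    apply le_antisymm
    · exact totalDegree_le_of_dualCoeff fun γ hγ => by rw [hΛ, hw.apply_eq_zero γ i hγ]
    -- The coefficient of Λᵢ at `αᵢ` is 1, so the order cannot be smaller.
    · by_contra! hlt
      have := hE i i
      rw [dualCoeff_eq_zero_of_totalDegree_lt hlt, if_pos rfl] at this
      exact zero_ne_one this
  have horth (i k) : diffFunctional ξ (Λ i) (shiftedMonomial ξ (α k)) = if i = k then 1 else 0 := by
    rw [diffFunctional_shiftedMonomial, hE]
  have hmem (i) : Λ i ∈ dualSpace ξ (hw.kerIdeal ξ) := by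
    rw [dualSpace, Submodule.mem_comap, Submodule.mem_dualAnnihilator]
    intro p hp
    rw [hfun]
    exact (hw.mem_kerIdeal hα).1 hp i
  have hexpand (Θ) (hΘ : Θ ∈ dualSpace ξ (hw.kerIdeal ξ)) :
      Θ = ∑ k, dualCoeff Θ (α k) • Λ k := by
    rw [dualSpace, Submodule.mem_comap, Submodule.mem_dualAnnihilator] at hΘ
    apply diffFunctional_injective ξ
    rw [hw.functional_eq_sum_of_kerIdeal hα ξ _ hΘ, map_sum]
    refine Finset.sum_congr rfl fun k _ => ?_
    rw [map_smul, hfun, diffFunctional_shiftedMonomial]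
  refine
    { primal_form := fun _ => rfl
      exponent_zero := hα.zero
      connected := fun i => or_iff_not_imp_left.2 fun hi => hα.exists_add_single hi
      orthogonal := horth
      order_monotone := by simpa only [hdegree] using hα.monotone
      order_zero := by rw [hdegree, hα.zero, map_zero]
      primal_independent := ?_
      primal_span := ?_
      dual_independent := ?_
      dual_span := ?_
      dual_zero := ?_
      dual_form := ?_
      order_span := ?_ }
  · rw [Fintype.linearIndependent_iff]
    intro g hg i
    have hg' : ∑ k, g k • shiftedMonomial ξ (α k) ∈ hw.kerIdeal ξ := by
      rw [← Ideal.Quotient.eq_zero_iff_mem, ← hg, map_sum]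
      rfl
    have := (hw.mem_kerIdeal hα).1 hg' i
    simpa [hw.apply_exponent hα, Pi.single_apply] using this
  · rw [eq_top_iff]
    rintro q -
    obtain ⟨p, rfl⟩ := Ideal.Quotient.mk_surjective q
    rw [Ideal.Quotient.eq.2 (hw.sub_sum_mem_kerIdeal hα ξ p), map_sum]
    exact Submodule.sum_mem _ fun k _ => Submodule.smul_mem _
      (momentFunctional ξ (fun γ => w γ k) p) (Submodule.subset_span (Set.mem_range_self k))
  · rw [Fintype.linearIndependent_iff]
    intro g hg i
    have h := congrArg (fun Θ => diffFunctional ξ Θ (shiftedMonomial ξ (α i))) hg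
    simpa [horth] using h
  · apply le_antisymm
    · rw [Submodule.span_le]
      rintro _ ⟨i, rfl⟩
      exact hmem i
    · intro Θ hΘ
      rw [hexpand Θ hΘ]
      exact Submodule.sum_mem _ fun k _ =>
        Submodule.smul_mem _ _ (Submodule.subset_span ⟨k, rfl⟩)
  · refine dualCoeff_injective fun γ => ?_
    have h1 : (1 : MvPolynomial (Fin n) ℂ) =
        monomial 0 (1 * (multiFactorial (0 : Fin n →₀ ℕ) : ℂ)⁻¹) := by
      simp [multiFactorial]
    rw [h1, dualCoeff_monomial_inv, hΛ]
    split_ifs with h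
    · rw [← h, hw.zero, Pi.single_eq_same]
    · refine hw.apply_eq_zero _ _ ?_
      rw [hα.zero, map_zero]
      exact Nat.pos_of_ne_zero fun h' => h ((Finsupp.degree_eq_zero_iff γ).1 h').symm
  · intro i
    classical
    let c : (Fin n →₀ ℕ) →₀ ℂ := Finsupp.onFinset
      (Finsupp.finite_of_degree_le (α i).degree).toFinset
      (fun γ => if γ.degree ≤ (α i).degree ∧ γ ∉ Set.range α then w γ i else 0)
      (by simp +contextual)
    have hc (γ) : c γ = if γ.degree ≤ (α i).degree ∧ γ ∉ Set.range α then w γ i else 0 := rfl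
    refine ⟨c, fun β hβ => ?_, ?_⟩
    · rw [Finsupp.mem_support_iff, hc] at hβ
      by_contra h
      exact hβ (if_neg h)
    · refine dualCoeff_injective fun γ => ?_
      rw [dualCoeff_add, dualCoeff_finsuppSum, hc,
        ← one_mul ((multiFactorial (α i) : ℂ)⁻¹), dualCoeff_monomial_inv, hΛ]
      by_cases hγ : γ ∈ Set.range α
      · obtain ⟨k, rfl⟩ := hγ
        have hk : ¬ ((α k).degree ≤ (α i).degree ∧ α k ∉ Set.range α) := fun h => h.2 ⟨k, rfl⟩
        rw [hw.apply_exponent hα, if_neg hk, add_zero, Pi.single_apply]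
        simp only [hα.injective.eq_iff]
      · rw [if_neg (fun h => hγ ⟨i, h⟩), zero_add]
        by_cases hle : γ.degree ≤ (α i).degree
        · rw [if_pos ⟨hle, hγ⟩]
        · rw [if_neg fun h => hle h.1, hw.apply_eq_zero _ _ (not_le.1 hle)]
  · intro t
    apply le_antisymm
    · rintro Θ ⟨hΘ, hdegΘ⟩
      rw [SetLike.mem_coe, mem_restrictTotalDegree] at hdegΘ
      rw [hexpand Θ hΘ]
      refine Submodule.sum_mem _ fun k _ => ?_
      by_cases hk : (α k).degree ≤ t
      · exact Submodule.smul_mem _ _ (Submodule.subset_span ⟨k, rfl, by rwa [hdegree]⟩)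
      · rw [dualCoeff_eq_zero_of_totalDegree_lt (by omega), zero_smul]
        exact Submodule.zero_mem _
    · rw [Submodule.span_le]
      rintro _ ⟨k, rfl, hk⟩
      exact ⟨hmem k, (mem_restrictTotalDegree _ _ _).2 hk⟩

end IsMultSeq

/-! ### Uniqueness of normalized pairs -/

namespace IsNormalizedPair

variable {α : Fin (d + 1) → (Fin n →₀ ℕ)} {ξ : Fin n → ℂ} {Q : Ideal (MvPolynomial (Fin n) ℂ)}
  {B Λ : Fin (d + 1) → MvPolynomial (Fin n) ℂ}

lemma apply_eq_zero (h : IsNormalizedPair α ξ Q B Λ) (i : Fin (d + 1))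
    {q : MvPolynomial (Fin n) ℂ} (hq : q ∈ Q) : diffFunctional ξ (Λ i) q = 0 := by
  have hi : Λ i ∈ dualSpace ξ Q := h.dual_span ▸ Submodule.subset_span ⟨i, rfl⟩
  rw [dualSpace, Submodule.mem_comap, Submodule.mem_dualAnnihilator] at hi
  exact hi q hq

/-- Orthogonality identifies the coordinates of `p` modulo `Q` in the basis `B` with the values of
the dual basis. -/
lemma sub_sum_mem (h : IsNormalizedPair α ξ Q B Λ) (p : MvPolynomial (Fin n) ℂ) :
    p - ∑ k, diffFunctional ξ (Λ k) p • B k ∈ Q := by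
  have hp : Ideal.Quotient.mk Q p ∈
      Submodule.span ℂ (Set.range fun i => Ideal.Quotient.mk Q (B i)) := by
    rw [h.primal_span]; trivial
  obtain ⟨g, hg⟩ := (Submodule.mem_span_range_iff_exists_fun ℂ).1 hp
  have hmem : p - ∑ k, g k • B k ∈ Q := by
    rw [← Ideal.Quotient.eq_zero_iff_mem, map_sub, ← hg, map_sum, sub_eq_zero]
    rfl
  have hg' (i) : diffFunctional ξ (Λ i) p = g i := by
    have h0 := h.apply_eq_zero i hmem
    rw [map_sub, sub_eq_zero] at h0
    rw [h0]
    simp [h.orthogonal]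
  simpa only [hg'] using hmem

lemma mem_iff (h : IsNormalizedPair α ξ Q B Λ) {p : MvPolynomial (Fin n) ℂ} :
    p ∈ Q ↔ ∀ i, diffFunctional ξ (Λ i) p = 0 := by
  refine ⟨fun hp i => h.apply_eq_zero i hp, fun hp => ?_⟩
  simpa [hp] using h.sub_sum_mem p

lemma dualCoeff_exponent (h : IsNormalizedPair α ξ Q B Λ) (i k : Fin (d + 1)) :
    dualCoeff (Λ i) (α k) = if i = k then 1 else 0 := by
  rw [← diffFunctional_shiftedMonomial ξ, ← h.primal_form, h.orthogonal]

lemma dualCoeff_eq_zero (h : IsNormalizedPair α ξ Q B Λ) (i : Fin (d + 1)) {γ : Fin n →₀ ℕ}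
    (hγ : (α i).degree < γ.degree) : dualCoeff (Λ i) γ = 0 := by
  obtain ⟨c, hc, hΛ⟩ := h.dual_form i
  rw [hΛ, dualCoeff_add, dualCoeff_finsuppSum, ← one_mul ((multiFactorial (α i) : ℂ)⁻¹),
    dualCoeff_monomial_inv, if_neg (by rintro rfl; exact lt_irrefl _ hγ), zero_add]
  by_contra hne
  have := (hc γ (Finsupp.mem_support_iff.2 hne)).1
  omega

/-- The dual coefficients of a normalized pair satisfy the recursion of `M(μ)^γ [1]`. -/
lemma isMultSeq (hα : IsExponentSet α) (h : IsNormalizedPair α ξ Q B Λ) {μ : Var α → ℂ}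
    (hμ : ∀ v : Var α, dualCoeff (Λ v.1.1) v.1.2 = μ v) :
    IsMultSeq α μ fun γ i => dualCoeff (Λ i) γ where
  zero := by
    funext i
    rw [Pi.single_apply, ← h.dualCoeff_exponent, hα.zero]
  add_single γ j := by
    funext i
    have hmat (k) : dualCoeff (Λ i) (α k + Finsupp.single j 1) = multMatrix α μ j i k :=
      eq_multMatrix hα i (dualCoeff (Λ i)) (h.dualCoeff_exponent i)
        (by rintro v rfl; exact hμ v) (fun _ hγ => h.dualCoeff_eq_zero i hγ) k j
    -- That `Q` is an ideal enters here: the remainder of `(x - ξ)^γ` stays in `Q` after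
    -- multiplication by `xⱼ - ξⱼ`, and applying Λᵢ gives the recursion.
    have hmem := Ideal.mul_mem_left Q (X j - C (ξ j)) (h.sub_sum_mem (shiftedMonomial ξ γ))
    have h0 := h.apply_eq_zero i hmem
    simp only [mul_sub, Finset.mul_sum, mul_smul_comm, h.primal_form,
      ← shiftedMonomial_add_single, map_sub, map_sum, map_smul, diffFunctional_shiftedMonomial,
      sub_eq_zero] at h0
    rw [h0, Matrix.mulVec, dotProduct]
    exact Finset.sum_congr rfl fun k _ => by rw [hmat, smul_eq_mul, mul_comm]

lemma unique (hα : IsExponentSet α) (h : IsNormalizedPair α ξ Q B Λ)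
    {Q' : Ideal (MvPolynomial (Fin n) ℂ)} {B' Λ' : Fin (d + 1) → MvPolynomial (Fin n) ℂ}
    (h' : IsNormalizedPair α ξ Q' B' Λ')
    (heq : ∀ v : Var α, dualCoeff (Λ' v.1.1) v.1.2 = dualCoeff (Λ v.1.1) v.1.2) :
    Q' = Q ∧ B' = B ∧ Λ' = Λ := by
  have hw := (h'.isMultSeq hα heq).unique (h.isMultSeq hα fun _ => rfl)
  have hΛ : Λ' = Λ := funext fun i => dualCoeff_injective fun γ => congrFun (congrFun hw γ) i
  refine ⟨?_, ?_, hΛ⟩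
  · ext p
    rw [h.mem_iff, h'.mem_iff, hΛ]
  · funext i
    rw [h.primal_form, h'.primal_form]

end IsNormalizedPair

end EDeflation

end

/-! ### Existence and uniqueness at an isolated zero. -/

theorem theorem3 {n N d : ℕ} (K : Subfield ℂ) (f : Fin N → MvPolynomial (Fin n) K)
    (I : Ideal (MvPolynomial (Fin n) K)) (hI : I = Ideal.span (Set.range f))
    (α : Fin (d + 1) → (Fin n →₀ ℕ)) (hα : EDeflation.IsExponentSet α)
    (ξ : Fin n → ℂ) (ν : EDeflation.Var α → ℂ)
    (hiso : EDeflation.IsIsolatedIn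
      (MvPolynomial.zeroLocus ℂ (EDeflation.deflatedIdeal α f)) (Sum.elim ξ ν))
    (t : Finset (Ideal (MvPolynomial (Fin n) ℂ)))
    (ht : Submodule.IsMinimalPrimaryDecomposition
      (I.map (MvPolynomial.map (algebraMap K ℂ))) t)
    (Q : Ideal (MvPolynomial (Fin n) ℂ))
    (hQ : Q = EDeflation.interBelow t ξ ⊔
      EDeflation.maxIdealAt ξ ^ ((α (Fin.last d)).degree + 1)) :
    ξ ∈ MvPolynomial.zeroLocus ℂ I ∧
    ∃ B Λ : Fin (d + 1) → MvPolynomial (Fin n) ℂ,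
      EDeflation.IsNormalizedPair α ξ Q B Λ ∧
      (∀ v : EDeflation.Var α, EDeflation.dualCoeff (Λ v.1.1) v.1.2 = ν v) ∧
      ∀ (Q' : Ideal (MvPolynomial (Fin n) ℂ)) (B' Λ' : Fin (d + 1) → MvPolynomial (Fin n) ℂ),
        EDeflation.IsNormalizedPair α ξ Q' B' Λ' →
        (∀ v : EDeflation.Var α, EDeflation.dualCoeff (Λ' v.1.1) v.1.2 = ν v) →
        Q' = Q ∧ B' = B ∧ Λ' = Λ := by
  open EDeflation MvPolynomial in
  have hzero : Sum.elim ξ ν ∈ zeroLocus ℂ (deflatedIdeal α f) := by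
    obtain ⟨U, -, hU⟩ := hiso
    exact (hU.symm ▸ Set.mem_singleton (Sum.elim ξ ν) :
      Sum.elim ξ ν ∈ zeroLocus ℂ (deflatedIdeal α f) ∩ U).1
  obtain ⟨w, hw, hwf⟩ := (EDeflation.mem_zeroLocus_deflatedIdeal K hα f ξ ν).1 hzero
  have hIker : I.map (MvPolynomial.map (algebraMap K ℂ)) ≤ hw.kerIdeal ξ := by
    rw [hI, Ideal.map_span, Ideal.span_le]
    rintro _ ⟨_, ⟨k, rfl⟩, rfl⟩
    exact (hw.mem_kerIdeal hα).2 (hwf k)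
  have hinf : t.inf id = I.map (MvPolynomial.map (algebraMap K ℂ)) := ht.inf_eq
  have hQker : Q ≤ hw.kerIdeal ξ := by
    rw [hQ]
    refine sup_le (fun p hp => ?_) (hw.maxIdealAt_pow_le ξ _)
    -- Localization at `ξ`: some `s` with `s(ξ) ≠ 0` sends `p` into the common kernel, modulo which
    -- `s` is a unit.
    obtain ⟨s, hs, hsp⟩ := EDeflation.interBelow_mul_mem (hinf.trans_le hIker) ξ hp
    exact hw.mem_annIdeal_of_mul_mem hs hsp
  have hfQ (k : Fin N) : MvPolynomial.map (algebraMap K ℂ) (f k) ∈ Q := by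
    rw [hQ]
    refine Ideal.mem_sup_left (EDeflation.le_interBelow t ξ ?_)
    rw [hinf, hI]
    exact Ideal.mem_map_of_mem _ (Ideal.subset_span ⟨k, rfl⟩)
  have hker : hw.kerIdeal ξ = Q := le_antisymm
    (EDeflation.kerIdeal_le_of_isIsolatedIn K hα f hiso hw hQker hfQ (hQ ▸ le_sup_right)) hQker
  have hΛ (i : Fin (d + 1)) (γ : Fin n →₀ ℕ) : EDeflation.dualCoeff
      (EDeflation.truncatedDual (α i).degree fun γ => w γ i) γ = w γ i :=
    EDeflation.dualCoeff_truncatedDual (fun γ hγ => hw.apply_eq_zero γ i hγ) γ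
  have hpair := hw.isNormalizedPair hα ξ hΛ
  rw [hker] at hpair
  have hcoef (v : EDeflation.Var α) : EDeflation.dualCoeff
      (EDeflation.truncatedDual (α v.1.1).degree fun γ => w γ v.1.1) v.1.2 = ν v := by
    obtain ⟨⟨i, β⟩, hv⟩ := v
    obtain ⟨k, j, hβ, -⟩ := id hv.2
    change β = _ at hβ
    subst hβ
    change EDeflation.dualCoeff (EDeflation.truncatedDual (α i).degree fun γ => w γ i) _ = _
    rw [hΛ, hw.apply_border hα, EDeflation.multMatrix_eq_var hv]
  refine ⟨fun p hp => ?_, _, _, hpair, hcoef, fun Q' B' Λ' h' hν' =>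
    hpair.unique hα h' fun v => (hν' v).trans (hcoef v).symm⟩
  have h0 := (hw.mem_kerIdeal hα).1 (hIker (Ideal.mem_map_of_mem _ hp)) 0
  rw [hw.functional_zero hα, AlgHom.toLinearMap_apply, MvPolynomial.aeval_map_algebraMap] at h0
  exact h0
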